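/- Let $n\ge 1$ be an integer and let $s\in\mathbb R$ satisfy $s-\frac n2\in(0,1)\cup(1,2)$. Let $P_\ell$ be the orthogonal projection of the real space $L^2(\mathbb S^n)$ (with the non-normalized surface measure) onto the spherical harmonics of degree $\ell\ge 0$, let $$\alpha_{2s}(\ell)=\frac{\Gamma(\ell+\frac n2+s)}{\Gamma(\ell+\frac n2-s)},\qquad H^s(\mathbb S^n)=\Big\{u\in L^2(\mathbb S^n):\ \sum_{\ell\ge0}(1+\ell)^{2s}\|P_\ell u\|_2^2<\infty\Big\},$$ and for $u,v\in H^s(\mathbb S^n)$ let $$a_{2s}[u,v]=\sum_{\ell\ge0}\alpha_{2s}(\ell)\,(P_\ell u,P_\ell v)_{L^2},\qquad a_{2s}[u]=a_{2s}[u,u].$$ Let $$\mathcal M=\Big\{\omega\mapsto c\,(1-\zeta\cdot\omega)^{\frac{2s-n}2}:\ c>0,\ \zeta\in\mathbb R^{n+1},\ |\zeta|<1\Big\}.$$ For $h\in\mathcal M$ let $T_h\mathcal M$ be the tangent space of $\mathcal M$ at $h$, that is, the set of all continuous functions $\eta$ on $\mathbb S^n$ with $\eta(\omega)=\frac{d}{dt}\big|_{t=0}\gamma_t(\omega)$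 for all $\omega\in\mathbb S^n$, for some path $t\mapsto\gamma_t$ that lies in $\mathcal M$ for $t$ near $0$ and has $\gamma_0=h$. Let $$(T_h\mathcal M)^\perp=\{\rho\in H^s(\mathbb S^n):\ a_{2s}[\rho,\varphi]=0\ \text{ for all }\varphi\in T_h\mathcal M\}.$$ For $u\in H^s(\mathbb S^n)$ write $u>0$ if the continuous representative of $u$ is positive at every point of $\mathbb S^n$, and for such $u$ let $$\mathsf d(u)=\inf\big\{a_{2s}[\rho]:\ u=h+\rho\ \text{ with } h\in\mathcal M,\ \rho\in(T_h\mathcal M)^\perp\big\}.$$ Then the following hold. 1. For every $h\in\mathcal M$, $a_{2s}$ is positive definite on $(T_h\mathcal M)^\perp$: $a_{2s}[\rho]>0$ for every $0\ne\rho\in(T_h\mathcal M)^\perp$. 2. For every $u\in H^s(\mathbb S^n)$ with $u>0$ there are $h\in\mathcal M$ and $\rho\in(T_h\mathcal M)^\perp$ such that $u=h+\rho$. 3. For every $u\in H^s(\mathbb S^n)$ with $u>0$, the set in the definition of $\mathsf d(u)$ is nonempty and bounded below, so that $\mathsf d(u)$ is a well-defined real number; and $\mathsf d(u)>0$ if $u\notin\mathcal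 M$. -/

import Mathlib

open MeasureTheory Topology

noncomputable section

namespace ReverseSobolev

/-- The unit sphere `𝕊ⁿ ⊂ ℝⁿ⁺¹`. -/
abbrev Sph (n : ℕ) : Type := Metric.sphere (0 : EuclideanSpace ℝ (Fin (n + 1))) 1

/-- The (non-normalized) surface measure on `𝕊ⁿ`. -/
abbrev surf (n : ℕ) : Measure (Sph n) :=
  (volume : Measure (EuclideanSpace ℝ (Fin (n + 1)))).toSphere

/-- The real Hilbert space `L²(𝕊ⁿ)`. -/
abbrev L2 (n : ℕ) : Type := Lp ℝ 2 (surf n)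

/-- The class in `L²(𝕊ⁿ)` of a continuous function. -/
def toL2 (n : ℕ) : C(Sph n, ℝ) →L[ℝ] L2 n := ContinuousMap.toLp 2 (surf n) ℝ

/-- Restriction of a polynomial in `n + 1` variables to the sphere. -/
def restrictPoly (n : ℕ) : MvPolynomial (Fin (n + 1)) ℝ →ₗ[ℝ] C(Sph n, ℝ) where
  toFun p := ⟨fun ω => MvPolynomial.eval (fun i => (ω : EuclideanSpace ℝ (Fin (n + 1))) i) p, by
    refine (MvPolynomial.continuous_eval p).comp (continuous_pi fun i => ?_)
    fun_prop⟩
  map_add' p q := by ext ω; simp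
  map_smul' c p := by ext ω; simp

/-- The Laplacian `∑ᵢ ∂ᵢ²` on polynomials. -/
def polyLaplacian (n : ℕ) : MvPolynomial (Fin (n + 1)) ℝ →ₗ[ℝ] MvPolynomial (Fin (n + 1)) ℝ :=
  ∑ i, (MvPolynomial.pderiv i).toLinearMap ∘ₗ (MvPolynomial.pderiv i).toLinearMap

/-- The spherical harmonics of degree `ℓ`: restrictions to `𝕊ⁿ` of the harmonic homogeneous
polynomials of degree `ℓ`, as a subspace of `L²(𝕊ⁿ)`. -/
def sphericalHarmonics (n ℓ : ℕ) : Submodule ℝ (L2 n) :=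
  (MvPolynomial.homogeneousSubmodule (Fin (n + 1)) ℝ ℓ ⊓ LinearMap.ker (polyLaplacian n)).map
    ((toL2 n).toLinearMap ∘ₗ restrictPoly n)

instance sphericalHarmonics_finiteDimensional (n ℓ : ℕ) :
    FiniteDimensional ℝ (sphericalHarmonics n ℓ) := by
  have : FiniteDimensional ℝ (MvPolynomial.homogeneousSubmodule (Fin (n + 1)) ℝ ℓ) :=
    Module.Finite.iff_fg.mpr (MvPolynomial.homogeneousSubmodule_fg _ _ ℓ)
  have : FiniteDimensional ℝ ↥(MvPolynomial.homogeneousSubmodule (Fin (n + 1)) ℝ ℓ ⊓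
      LinearMap.ker (polyLaplacian n)) :=
    Submodule.finiteDimensional_inf_left _ _
  unfold sphericalHarmonics
  infer_instance

/-- The `L²`-orthogonal projection `P_ℓ` onto the spherical harmonics of degree `ℓ`. -/
def P (n ℓ : ℕ) : L2 n →L[ℝ] L2 n := (sphericalHarmonics n ℓ).starProjection

/-- The eigenvalue `α_{2s}(ℓ) = Γ(ℓ + n/2 + s) / Γ(ℓ + n/2 - s)`. As `Real.Gamma` vanishes at its
poles and `x / 0 = 0`, this is `0` when `ℓ + n/2 - s` is a nonpositive integer. -/
def α (n : ℕ) (s : ℝ) (ℓ : ℕ) : ℝ :=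
  Real.Gamma (ℓ + n / 2 + s) / Real.Gamma (ℓ + n / 2 - s)

/-- The Sobolev space `H^s(𝕊ⁿ)`, as a set of elements of `L²(𝕊ⁿ)`. -/
def Hs (n : ℕ) (s : ℝ) : Set (L2 n) :=
  {u | Summable fun ℓ : ℕ => (1 + (ℓ : ℝ)) ^ (2 * s) * ‖P n ℓ u‖ ^ 2}

/-- The bilinear form `a_{2s}[u, v] = ∑_ℓ α_{2s}(ℓ) (P_ℓ u, P_ℓ v)`; the series converges
absolutely for `u, v ∈ H^s(𝕊ⁿ)`. -/
def aBilin (n : ℕ) (s : ℝ) (u v : L2 n) : ℝ :=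
  ∑' ℓ : ℕ, α n s ℓ * inner ℝ (P n ℓ u) (P n ℓ v)

/-- The quadratic form `a_{2s}[u] = ∑_ℓ α_{2s}(ℓ) ‖P_ℓ u‖²`. -/
def aQuad (n : ℕ) (s : ℝ) (u : L2 n) : ℝ :=
  ∑' ℓ : ℕ, α n s ℓ * ‖P n ℓ u‖ ^ 2

/-- `u > 0`: the continuous representative of `u` is positive at every point of the sphere.
(For `s > n/2` every element of `H^s(𝕊ⁿ)` has a unique continuous representative.) -/
def IsPos {n : ℕ} (u : L2 n) : Prop :=
  ∃ f : C(Sph n, ℝ), toL2 n f = u ∧ ∀ ω, 0 < f ω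

/-- The manifold `𝓜` of the functions `ω ↦ c (1 - ζ·ω)^((2s-n)/2)` with `c > 0`, `|ζ| < 1`. -/
def optimizers (n : ℕ) (s : ℝ) : Set C(Sph n, ℝ) :=
  {h | ∃ c : ℝ, 0 < c ∧ ∃ ζ : EuclideanSpace ℝ (Fin (n + 1)), ‖ζ‖ < 1 ∧
    ∀ ω : Sph n, h ω =
      c * (1 - inner ℝ ζ (ω : EuclideanSpace ℝ (Fin (n + 1)))) ^ ((2 * s - n) / 2)}

/-- The tangent space `T_h 𝓜`: velocities at time `0` of paths in `𝓜` through `h`. -/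
def tangentSpace (n : ℕ) (s : ℝ) (h : C(Sph n, ℝ)) : Set C(Sph n, ℝ) :=
  {η | ∃ γ : ℝ → C(Sph n, ℝ), (∀ᶠ t in 𝓝 0, γ t ∈ optimizers n s) ∧ γ 0 = h ∧
    ∀ ω, HasDerivAt (fun t => γ t ω) (η ω) 0}

/-- `(T_h 𝓜)^⊥`, the orthogonal complement in `H^s(𝕊ⁿ)` with respect to `a_{2s}`. -/
def tangentPerp (n : ℕ) (s : ℝ) (h : C(Sph n, ℝ)) : Set (L2 n) :=
  {ρ | ρ ∈ Hs n s ∧ ∀ φ ∈ tangentSpace n s h, aBilin n s ρ (toL2 n φ) = 0}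

/-- The values `a_{2s}[ρ]` over all decompositions `u = h + ρ`, `h ∈ 𝓜`, `ρ ∈ (T_h 𝓜)^⊥`. -/
def distValues (n : ℕ) (s : ℝ) (u : L2 n) : Set ℝ :=
  {t | ∃ h ∈ optimizers n s, ∃ ρ ∈ tangentPerp n s h, u = toL2 n h + ρ ∧ t = aQuad n s ρ}

/-- The modified distance `𝖽(u)` to `𝓜`. -/
def dist (n : ℕ) (s : ℝ) (u : L2 n) : ℝ := sInf (distValues n s u)

end ReverseSobolev

end

/-
With `β = s - n/2`, conformal changes of variables show that the operator with eigenvalues `α`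
maps the kernel `confFactor ζ ^ β` to `α n s 0 • confFactor ζ ^ (-(n/2 + s))`, and its variation
in `ζ` to `α n s 1` times the corresponding product. So `T_h 𝓜` is spanned by one direction on
which the form has the sign of `α n s 0` and `n + 1` directions on which it has the sign of
`α n s 1`. Exactly one of the two eigenvalues is negative (the first if `β < 1`, the second if
`β > 1`) and all the others are positive; hence `T_h 𝓜` contains a negative subspace of maximal
dimension, and the form is positive definite on its orthogonal complement.

The decompositions of a positive `f` correspond to the critical points of
`M(ζ) = ∫ f · confFactor ζ ^ (-(n/2 + s))` on the unit ball, with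
`a_{2s}[ρ] = a_{2s}[f] - α n s 0 * M(ζ)² / |𝕊ⁿ|`. As `M → ∞` at the boundary of the ball, a minimum
of `M` gives a decomposition. Moreover, bounds on `a_{2s}[ρ]` confine the critical points to a
compact set, so the infimum defining the distance is attained.
-/

noncomputable section

namespace ReverseSobolev

section Hypergeometric

open PowerSeries
open scoped Nat

/-- The Gauss hypergeometric series `₂F₁(a, b; c; X)` as a formal power series. -/
def hypergeomSeries (a b c : ℝ) : ℝ⟦X⟧ := mk (ordinaryHypergeometricCoefficient a b c)

/-- The hypergeometric differential equation
`X (1 - X) y'' + (c - (a + b + 1) X) y' - a b y = 0`, for formal power series. -/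
def SolvesHypergeomODE (a b c : ℝ) (y : ℝ⟦X⟧) : Prop :=
  X * (1 - X) * d⁄dX ℝ (d⁄dX ℝ y) + (C c - C (a + b + 1) * X) * d⁄dX ℝ y - C (a * b) * y = 0

lemma solvesHypergeomODE_iff {a b c : ℝ} {y : ℝ⟦X⟧} :
    SolvesHypergeomODE a b c y ↔
      ∀ k : ℕ, (k + 1) * (c + k) * coeff (k + 1) y = (a + k) * (b + k) * coeff k y := by
  have hODE : X * (1 - X) * d⁄dX ℝ (d⁄dX ℝ y) + (C c - C (a + b + 1) * X) * d⁄dX ℝ y -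
      C (a * b) * y = X * d⁄dX ℝ (d⁄dX ℝ y) - X * (X * d⁄dX ℝ (d⁄dX ℝ y)) + C c * d⁄dX ℝ y -
      C (a + b + 1) * (X * d⁄dX ℝ y) - C (a * b) * y := by ring
  rw [SolvesHypergeomODE, hODE, PowerSeries.ext_iff]
  refine forall_congr' fun k => ?_
  rw [map_zero, ← sub_eq_zero (a := (k + 1 : ℝ) * _ * _)]
  refine Eq.congr ?_ rfl
  rcases k with _ | _ | k <;>
  · simp only [LinearMap.map_add, LinearMap.map_sub, coeff_succ_X_mul, coeff_zero_X_mul,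
      coeff_C_mul, coeff_derivative]
    push_cast
    ring

lemma coeff_zero_hypergeomSeries (a b c : ℝ) : coeff 0 (hypergeomSeries a b c) = 1 := by
  simp [hypergeomSeries, ordinaryHypergeometricCoefficient]

lemma solvesHypergeomODE_hypergeomSeries {a b c : ℝ} (hc : ∀ k : ℕ, c + k ≠ 0) :
    SolvesHypergeomODE a b c (hypergeomSeries a b c) := by
  refine solvesHypergeomODE_iff.2 fun k => ?_
  simp only [hypergeomSeries, ordinaryHypergeometricCoefficient, coeff_mk, ascPochhammer_succ_eval,
    Nat.factorial_succ, mul_inv]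
  have := hc k
  push_cast
  field_simp

lemma SolvesHypergeomODE.eq_hypergeomSeries {a b c : ℝ} (hc : ∀ k : ℕ, c + k ≠ 0) {y : ℝ⟦X⟧}
    (hy : SolvesHypergeomODE a b c y) (h0 : coeff 0 y = 1) : y = hypergeomSeries a b c := by
  ext k
  induction k with
  | zero => rw [h0, coeff_zero_hypergeomSeries]
  | succ k ih =>
    have h1 := solvesHypergeomODE_iff.1 hy k
    rw [ih, ← solvesHypergeomODE_iff.1 (solvesHypergeomODE_hypergeomSeries hc) k] at h1
    exact mul_left_cancel₀ (mul_ne_zero k.cast_add_one_ne_zero (hc k)) h1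

/-- The formal power series of `(1 - X) ^ p`. -/
def oneSubPow (p : ℝ) : ℝ⟦X⟧ := mk fun k => (ascPochhammer ℝ k).eval (-p) / k !

lemma coeff_zero_oneSubPow (p : ℝ) : coeff 0 (oneSubPow p) = 1 := by
  simp [oneSubPow]

lemma coeff_succ_oneSubPow (p : ℝ) (k : ℕ) :
    (k + 1) * coeff (k + 1) (oneSubPow p) = (k - p) * coeff k (oneSubPow p) := by
  simp only [oneSubPow, coeff_mk, ascPochhammer_succ_eval, Nat.factorial_succ]
  push_cast
  field_simp
  ring

lemma derivative_oneSubPow (p : ℝ) :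
    (1 - X) * d⁄dX ℝ (oneSubPow p) = -(C p * oneSubPow p) := by
  ext k
  have h := coeff_succ_oneSubPow p k
  rw [sub_mul, one_mul]
  rcases k with _ | k <;>
  · simp only [map_sub, map_neg, coeff_succ_X_mul, coeff_zero_X_mul, coeff_C_mul, coeff_derivative]
    push_cast at h ⊢
    linear_combination h

lemma SolvesHypergeomODE.oneSubPow_mul {a b c : ℝ} {w : ℝ⟦X⟧}
    (hw : SolvesHypergeomODE (c - a) (c - b) c w) :
    SolvesHypergeomODE a b c (oneSubPow (c - a - b) * w) := by
  set v := oneSubPow (c - a - b)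
  have hv : (1 - X) * d⁄dX ℝ v = -(C (c - a - b) * v) := derivative_oneSubPow _
  have hv' : (1 - X) * d⁄dX ℝ (d⁄dX ℝ v) = (1 - C (c - a - b)) * d⁄dX ℝ v := by
    have := congrArg (d⁄dX ℝ) hv
    simp only [Derivation.leibniz, map_sub, map_neg, derivative_X, derivative_C,
      Derivation.map_one_eq_zero, smul_eq_mul] at this
    simp only [map_sub]
    linear_combination this
  have h1X : (1 - X : ℝ⟦X⟧) ≠ 0 := fun h => by simpa using congrArg (coeff 0) h
  refine mul_left_cancel₀ h1X ?_
  unfold SolvesHypergeomODE at hw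
  simp only [Derivation.leibniz, map_add, smul_eq_mul]
  simp only [map_add, map_sub, map_mul, map_one] at *
  linear_combination (1 - X) * v * hw + X * (1 - X) * w * hv' +
    (2 * X * (1 - X) * d⁄dX ℝ w + (C c - (C a + C b + 1) * X) * w +
      X * w * (1 - (C c - C a - C b))) * hv

theorem hypergeomSeries_eq_oneSubPow_mul (a b : ℝ) {c : ℝ} (hc : ∀ k : ℕ, c + k ≠ 0) :
    hypergeomSeries a b c = oneSubPow (c - a - b) * hypergeomSeries (c - a) (c - b) c :=
  ((solvesHypergeomODE_hypergeomSeries hc).oneSubPow_mul.eq_hypergeomSeries hc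
    (by simp [coeff_mul, coeff_zero_hypergeomSeries, coeff_zero_oneSubPow,
      -coeff_zero_eq_constantCoeff])).symm

lemma coeff_oneSubPow (p : ℝ) (k : ℕ) :
    coeff k (oneSubPow p) = (-1) ^ k * Ring.choose p k := by
  rw [oneSubPow, coeff_mk, Ring.choose_eq_smul, Polynomial.descPochhammer_smeval_eq_ascPochhammer,
    Polynomial.ascPochhammer_smeval_cast, Polynomial.ascPochhammer_smeval_eq_eval,
    ascPochhammer_eval_neg_eq_descPochhammer, descPochhammer_eval_eq_ascPochhammer, smul_eq_mul]
  ring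

lemma hasSum_oneSubPow (p : ℝ) {x : ℝ} (hx : |x| < 1) :
    HasSum (fun k => coeff k (oneSubPow p) * x ^ k) ((1 - x) ^ p) := by
  have h := (Real.one_add_rpow_hasFPowerSeriesOnBall_zero (a := p)).hasSum (y := -x) (by
    simpa [enorm_eq_nnnorm, ← NNReal.coe_lt_one] using! hx)
  simp only [binomialSeries_apply, List.ofFn_const, List.prod_replicate, smul_eq_mul, zero_add] at h
  refine h.congr_fun fun k => ?_
  rw [coeff_oneSubPow, neg_pow]
  ring

lemma one_le_radius_ordinaryHypergeometricSeries (a b c : ℝ) :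
    1 ≤ (ordinaryHypergeometricSeries ℝ a b c).radius := by
  by_cases h : ∃ k : ℕ, k = -a ∨ k = -b ∨ k = -c
  · obtain ⟨k, h⟩ := h
    refine le_top.trans_eq (FormalMultilinearSeries.radius_eq_top_of_forall_image_add_eq_zero
      _ (k + 1) fun m => ?_).symm
    exact ordinaryHypergeometricSeries_eq_zero_of_neg_nat a b c h (by omega)
  · exact (ordinaryHypergeometricSeries_radius_eq_one ℝ a b c (by simpa using h)).ge

lemma hasSum_hypergeomSeries (a b c : ℝ) {x : ℝ} (hx : |x| < 1) :
    HasSum (fun k => coeff k (hypergeomSeries a b c) * x ^ k) (₂F₁ a b c x) := by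
  have hball : x ∈ Metric.eball 0 (ordinaryHypergeometricSeries ℝ a b c).radius :=
    Metric.eball_subset_eball (one_le_radius_ordinaryHypergeometricSeries a b c) (by
      simpa [enorm_eq_nnnorm, ← NNReal.coe_lt_one] using! hx)
  refine (FormalMultilinearSeries.hasSum _ hball).congr_fun fun k => ?_
  rw [ordinaryHypergeometricSeries_apply_eq, hypergeomSeries, coeff_mk, smul_eq_mul]

theorem ordinaryHypergeometric_euler (a b : ℝ) {c x : ℝ} (hc : ∀ k : ℕ, c + k ≠ 0)
    (hx : |x| < 1) :
    ₂F₁ a b c x = (1 - x) ^ (c - a - b) * ₂F₁ (c - a) (c - b) c x := by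
  have hf := hasSum_oneSubPow (c - a - b) hx
  have hg := hasSum_hypergeomSeries (c - a) (c - b) c hx
  have hfg := (summable_norm_sum_mul_antidiagonal_of_summable_norm hf.summable.norm
    hg.summable.norm).of_norm.hasSum
  rw [← tsum_mul_tsum_eq_tsum_sum_antidiagonal_of_summable_norm hf.summable.norm hg.summable.norm,
    hf.tsum_eq, hg.tsum_eq] at hfg
  refine (hasSum_hypergeomSeries a b c hx).unique (hfg.congr_fun fun k => ?_)
  rw [hypergeomSeries_eq_oneSubPow_mul a b hc, coeff_mul, Finset.sum_mul]
  refine Finset.sum_congr rfl fun ij hij => ?_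
  rw [← Finset.HasAntidiagonal.mem_antidiagonal.1 hij, pow_add]
  ring

end Hypergeometric

section ParametricIntegral

variable {X : Type*} [TopologicalSpace X] [CompactSpace X] [MeasurableSpace X]
  [OpensMeasurableSpace X] {μ : Measure X} [IsFiniteMeasureOnCompacts μ]

lemma integrable_of_continuous {f : X → ℝ} (hf : Continuous f) : Integrable f μ :=
  hf.integrable_of_hasCompactSupport (.of_compactSpace f)

lemma hasDerivAt_integral_of_continuousOn {F F' : ℝ → X → ℝ} {U : Set ℝ} {t₀ : ℝ}
    (hU : U ∈ 𝓝 t₀) (hF : ∀ t ∈ U, Continuous (F t))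
    (hF' : ContinuousOn (Function.uncurry F') (U ×ˢ Set.univ))
    (hderiv : ∀ t ∈ U, ∀ x, HasDerivAt (F · x) (F' t x) t) :
    HasDerivAt (fun t => ∫ x, F t x ∂μ) (∫ x, F' t₀ x ∂μ) t₀ := by
  obtain ⟨ε, hε, hεU⟩ := Metric.nhds_basis_closedBall.mem_iff.1 hU
  obtain ⟨C, hC⟩ := ((isCompact_closedBall t₀ ε).prod isCompact_univ).exists_bound_of_continuousOn
    (hF'.mono (Set.prod_mono hεU subset_rfl))
  have hF't₀ : Continuous (F' t₀) := hF'.comp_continuous (f := fun x => (t₀, x)) (by fun_prop)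
    fun x => ⟨mem_of_mem_nhds hU, Set.mem_univ x⟩
  refine (hasDerivAt_integral_of_dominated_loc_of_deriv_le (bound := fun _ => C)
    (Metric.closedBall_mem_nhds t₀ hε) ?_ ?_ ?_ ?_ ?_ ?_).2
  · filter_upwards [hU] with t ht using (integrable_of_continuous (hF t ht)).aestronglyMeasurable
  · exact integrable_of_continuous (hF t₀ (mem_of_mem_nhds hU))
  · exact (integrable_of_continuous hF't₀).aestronglyMeasurable
  · exact .of_forall fun x t ht => hC (t, x) ⟨ht, Set.mem_univ x⟩
  · exact integrable_of_continuous continuous_const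
  · exact .of_forall fun x t ht => hderiv t (hεU ht) x

end ParametricIntegral

section SphereIntegral

open MvPolynomial
open scoped Pointwise

section Isometry

variable {E : Type*} [NormedAddCommGroup E] [InnerProductSpace ℝ E]

/-- The homeomorphism of the unit sphere induced by a linear isometry. -/
def sphereHomeomorph (e : E ≃ₗᵢ[ℝ] E) :
    Metric.sphere (0 : E) 1 ≃ₜ Metric.sphere (0 : E) 1 :=
  e.toHomeomorph.subtype fun x => by simp

variable [FiniteDimensional ℝ E] [MeasurableSpace E] [BorelSpace E]

lemma measurePreserving_sphereHomeomorph (e : E ≃ₗᵢ[ℝ] E) :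
    MeasurePreserving (sphereHomeomorph e) (volume : Measure E).toSphere
      (volume : Measure E).toSphere := by
  refine ⟨(sphereHomeomorph e).measurable, Measure.ext fun s hs => ?_⟩
  have hcone : Set.Ioo (0 : ℝ) 1 • ((↑) '' (sphereHomeomorph e ⁻¹' s) : Set E) =
      e ⁻¹' (Set.Ioo (0 : ℝ) 1 • ((↑) '' s : Set E)) := by
    ext x
    simp only [Set.mem_smul, Set.mem_image, Set.mem_preimage, exists_exists_and_eq_and]
    refine exists_congr fun r => and_congr_right fun _ => ⟨?_, ?_⟩
    · rintro ⟨ω, hω, rfl⟩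
      exact ⟨_, hω, (e.map_smul r ω).symm⟩
    · rintro ⟨ω, hω, hx⟩
      refine ⟨(sphereHomeomorph e).symm ω, by simpa using hω, e.injective ?_⟩
      rw [e.map_smul, ← hx]
      exact congrArg (fun y : Metric.sphere (0 : E) 1 => r • (y : E))
        ((sphereHomeomorph e).apply_symm_apply ω)
  rw [Measure.map_apply (sphereHomeomorph e).measurable hs, Measure.toSphere_apply' _ hs,
    Measure.toSphere_apply' _ ((sphereHomeomorph e).measurable hs), hcone,
    e.measurePreserving.measure_preimage_emb e.toHomeomorph.measurableEmbedding]

lemma integral_toSphere_comp_linearIsometryEquiv (e : E ≃ₗᵢ[ℝ] E) (f : E → ℝ) :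
    ∫ ω : Metric.sphere (0 : E) 1, f (e ω) ∂(volume : Measure E).toSphere =
      ∫ ω : Metric.sphere (0 : E) 1, f ω ∂(volume : Measure E).toSphere :=
  (measurePreserving_sphereHomeomorph e).integral_comp
    (sphereHomeomorph e).measurableEmbedding (fun ω => f ω)

end Isometry

lemma hasDerivAt_eval_comp {ι : Type*} [Fintype ι] (Q : MvPolynomial ι ℝ) {γ : ℝ → ι → ℝ}
    {γ' : ι → ℝ} {t : ℝ} (hγ : ∀ i, HasDerivAt (fun u => γ u i) (γ' i) t) :
    HasDerivAt (fun u => eval (γ u) Q) (∑ i, γ' i * eval (γ t) (pderiv i Q)) t := by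
  classical
  induction Q using MvPolynomial.induction_on with
  | C a => simpa using hasDerivAt_const t a
  | add p q hp hq => simpa [mul_add, Finset.sum_add_distrib] using hp.fun_add hq
  | mul_X p j hp =>
    simp only [Derivation.leibniz, map_add, smul_eq_mul, map_mul, eval_X, pderiv_X]
    refine (hp.mul (hγ j)).congr_deriv ?_
    simp only [mul_add, Finset.sum_add_distrib, Pi.single_apply, Finset.sum_mul]
    rw [add_comm]
    refine congrArg₂ _ ?_ (Finset.sum_congr rfl fun i _ => by ring)
    rw [Finset.sum_eq_single j (fun i _ hij => by simp [hij.symm]) (by simp)]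
    simp [mul_comm]

lemma eval_smul_of_isHomogeneous {ι : Type*} {q : ℕ} {Q : MvPolynomial ι ℝ}
    (hQ : Q.IsHomogeneous q) (r : ℝ) (x : ι → ℝ) : eval (r • x) Q = r ^ q * eval x Q := by
  simp only [eval_eq, Finset.mul_sum]
  refine Finset.sum_congr rfl fun d hd => ?_
  have hdeg : ∑ i ∈ d.support, d i = q := by
    simpa [Finsupp.weight_apply, Finsupp.sum] using hQ (mem_support_iff.1 hd)
  simp only [Pi.smul_apply, smul_eq_mul, mul_pow, Finset.prod_mul_distrib,
    Finset.prod_pow_eq_pow_sum, hdeg]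
  ring

/-- The Euclidean space `ℝⁿ⁺¹`. -/
abbrev Eu (n : ℕ) : Type := EuclideanSpace ℝ (Fin (n + 1))

variable {n : ℕ}

/-- The integral of a polynomial over the sphere, as a linear functional. -/
def polyIntegral (n : ℕ) : MvPolynomial (Fin (n + 1)) ℝ →ₗ[ℝ] ℝ where
  toFun Q := ∫ ω, restrictPoly n Q ω ∂surf n
  map_add' Q R := by
    simp only [map_add, ContinuousMap.add_apply]
    exact integral_add (integrable_of_continuous (map_continuous _))
      (integrable_of_continuous (map_continuous _))
  map_smul' c Q := by
    simp only [map_smul, ContinuousMap.smul_apply, RingHom.id_apply, integral_smul]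

lemma restrictPoly_apply (Q : MvPolynomial (Fin (n + 1)) ℝ) (ω : Sph n) :
    restrictPoly n Q ω = eval (ω : Eu n) Q := rfl

lemma polyIntegral_congr {Q R : MvPolynomial (Fin (n + 1)) ℝ}
    (h : restrictPoly n Q = restrictPoly n R) : polyIntegral n Q = polyIntegral n R :=
  congrArg (fun f : C(Sph n, ℝ) => ∫ ω, f ω ∂surf n) h

lemma polyIntegral_eq_integral_comp (e : Eu n ≃ₗᵢ[ℝ] Eu n)
    (Q : MvPolynomial (Fin (n + 1)) ℝ) :
    polyIntegral n Q = ∫ ω : Sph n, eval (e ω) Q ∂surf n :=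
  (integral_toSphere_comp_linearIsometryEquiv e fun x => eval x Q).symm

lemma polyIntegral_eq_zero_of_odd {q : ℕ} (hq : Odd q) {Q : MvPolynomial (Fin (n + 1)) ℝ}
    (hQ : Q.IsHomogeneous q) : polyIntegral n Q = 0 := by
  let e : Eu n ≃ₗᵢ[ℝ] Eu n := LinearIsometryEquiv.neg ℝ
  have hneg (ω : Sph n) : eval (e ω) Q = -restrictPoly n Q ω := by
    have h := eval_smul_of_isHomogeneous hQ (-1) (ω : Eu n)
    rw [hq.neg_one_pow, neg_one_mul] at h
    rw [restrictPoly_apply, ← h]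
    simp [e, Pi.neg_def]
  have h := polyIntegral_eq_integral_comp e Q
  simp only [hneg, integral_neg] at h
  exact self_eq_neg.1 h

section Reflection

variable {E : Type*} [NormedAddCommGroup E] [InnerProductSpace ℝ E]

lemma reflection_span_singleton_apply {u : E} (hu : ‖u‖ = 1) (x : E) :
    (ℝ ∙ u).reflection x = (2 : ℝ) • (inner ℝ u x • u) - x := by
  simp [Submodule.reflection_singleton_apply, hu, two_smul]

lemma hasDerivAt_reflection_span_singleton {u : ℝ → E} {u' : E} {t : ℝ} (hu : ∀ t, ‖u t‖ = 1)
    (hu' : HasDerivAt u u' t) (x : E) :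
    HasDerivAt (fun t => (ℝ ∙ u t).reflection x)
      ((2 : ℝ) • (inner ℝ (u t) x • u' + inner ℝ u' x • u t)) t := by
  simp only [reflection_span_singleton_apply (hu _)]
  have hinner : HasDerivAt (fun t => inner ℝ (u t) x) (inner ℝ u' x) t := by
    simpa using hu'.inner ℝ (hasDerivAt_const t x)
  exact ((hinner.smul hu').const_smul 2).sub_const x

end Reflection

lemma integral_deriv_eval_linearIsometryEquiv {σ : ℝ → Eu n ≃ₗᵢ[ℝ] Eu n} {σ' : ℝ → Eu n → Eu n}
    (hσ : ∀ t x, HasDerivAt (fun t => σ t x) (σ' t x) t)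
    (hσ_cont : Continuous fun p : ℝ × Eu n => σ p.1 p.2)
    (hσ'_cont : Continuous fun p : ℝ × Eu n => σ' p.1 p.2) (t : ℝ)
    (Q : MvPolynomial (Fin (n + 1)) ℝ) :
    ∫ ω : Sph n, ∑ k, σ' t ω k * eval (σ t ω) (pderiv k Q) ∂surf n = 0 := by
  have hsub : Continuous fun p : ℝ × Sph n => (p.1, (p.2 : Eu n)) := by fun_prop
  have heval (R : MvPolynomial (Fin (n + 1)) ℝ) :
      Continuous fun p : ℝ × Sph n => eval (σ p.1 p.2) R :=
    (continuous_eval R).comp ((PiLp.continuous_ofLp 2 _).comp (hσ_cont.comp hsub))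
  have hcoord (k : Fin (n + 1)) : Continuous fun p : ℝ × Sph n => σ' p.1 p.2 k :=
    (EuclideanSpace.proj (𝕜 := ℝ) k).continuous.comp (hσ'_cont.comp hsub)
  have hderiv (t : ℝ) (ω : Sph n) : HasDerivAt (fun t => eval (σ t ω) Q)
      (∑ k, σ' t ω k * eval (σ t ω) (pderiv k Q)) t :=
    hasDerivAt_eval_comp Q fun k =>
      (EuclideanSpace.proj (𝕜 := ℝ) k).hasFDerivAt.comp_hasDerivAt t (hσ t ω)
  have hcont : Continuous fun p : ℝ × Sph n =>
      ∑ k, σ' p.1 p.2 k * eval (σ p.1 p.2) (pderiv k Q) :=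
    continuous_finsetSum _ fun k _ => (hcoord k).mul (heval _)
  have hF (t : ℝ) : Continuous fun ω : Sph n => eval (σ t ω) Q :=
    (heval Q).comp (f := fun ω : Sph n => (t, ω)) (by fun_prop)
  have h := hasDerivAt_integral_of_continuousOn (μ := surf n) (t₀ := t)
    (F := fun t ω => eval (σ t ω) Q) (F' := fun t ω => ∑ k, σ' t ω k * eval (σ t ω) (pderiv k Q))
    Filter.univ_mem (fun t _ => hF t) hcont.continuousOn fun t _ ω => hderiv t ω
  refine h.unique ((hasDerivAt_const t (polyIntegral n Q)).congr_of_eventuallyEq ?_)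
  exact .of_forall fun t => (polyIntegral_eq_integral_comp (σ t) Q).symm

-- Apply the preceding lemma to the reflections in the lines spanned by `cos t eᵢ + sin t eⱼ`.
lemma polyIntegral_X_mul_pderiv_comm (i j : Fin (n + 1)) (Q : MvPolynomial (Fin (n + 1)) ℝ) :
    polyIntegral n (X j * pderiv i Q) = polyIntegral n (X i * pderiv j Q) := by
  obtain rfl | hij := eq_or_ne i j
  · rfl
  let u (t : ℝ) : Eu n :=
    Real.cos t • EuclideanSpace.single i 1 + Real.sin t • EuclideanSpace.single j 1
  let u' (t : ℝ) : Eu n :=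
    -Real.sin t • EuclideanSpace.single i 1 + Real.cos t • EuclideanSpace.single j 1
  have hu (t : ℝ) : ‖u t‖ = 1 := by
    rw [← sq_eq_sq₀ (norm_nonneg _) zero_le_one, norm_add_sq_real]
    simp [norm_smul, inner_smul_left, inner_smul_right, EuclideanSpace.inner_single_left, hij]
  have hu' (t : ℝ) : HasDerivAt u (u' t) t :=
    ((Real.hasDerivAt_cos t).smul_const _).add ((Real.hasDerivAt_sin t).smul_const _)
  have h := integral_deriv_eval_linearIsometryEquiv
    (fun t x => hasDerivAt_reflection_span_singleton hu (hu' t) x)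
    (by simp only [reflection_span_singleton_apply (hu _), u]; fun_prop)
    (by simp only [u, u']; fun_prop) 0 Q
  have hrefl (ω : Sph n) : ∑ k, ((2 : ℝ) • (inner ℝ (u 0) (ω : Eu n) • u' 0 +
      inner ℝ (u' 0) (ω : Eu n) • u 0)) k * eval ((ℝ ∙ u 0).reflection (ω : Eu n)) (pderiv k Q) =
      2 * eval ((ℝ ∙ u 0).reflection (ω : Eu n)) (X i * pderiv j Q - X j * pderiv i Q) := by
    simp only [reflection_span_singleton_apply (hu 0)]
    simp [u, u', EuclideanSpace.inner_single_left, mul_add, add_mul,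
      Finset.sum_add_distrib, hij.symm]
    ring
  rw [integral_congr_ae (.of_forall hrefl), integral_const_mul, ← polyIntegral_eq_integral_comp,
    map_sub] at h
  linarith

end SphereIntegral

section SphericalHarmonics

open MvPolynomial

variable {n : ℕ}

/-- The polynomial `∑ᵢ xᵢ²`. -/
def normSqPoly (n : ℕ) : MvPolynomial (Fin (n + 1)) ℝ := ∑ i, X i ^ 2

lemma normSqPoly_isHomogeneous (n : ℕ) : (normSqPoly n).IsHomogeneous 2 :=
  .sum _ _ _ fun i _ => isHomogeneous_X_pow i 2

lemma restrictPoly_mul (Q R : MvPolynomial (Fin (n + 1)) ℝ) :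
    restrictPoly n (Q * R) = restrictPoly n Q * restrictPoly n R := by
  ext ω
  simp [restrictPoly_apply]

lemma restrictPoly_normSqPoly (n : ℕ) : restrictPoly n (normSqPoly n) = 1 := by
  ext ω
  have h : ‖(ω : Eu n)‖ ^ 2 = 1 := by simp
  rw [EuclideanSpace.norm_sq_eq] at h
  simpa [restrictPoly_apply, normSqPoly] using h

lemma polyIntegral_normSqPoly_mul (Q : MvPolynomial (Fin (n + 1)) ℝ) :
    polyIntegral n (normSqPoly n * Q) = polyIntegral n Q :=
  polyIntegral_congr (by rw [restrictPoly_mul, restrictPoly_normSqPoly, one_mul])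

-- Sum the rotation identity for `X j * Q` over `j` and use Euler's identity.
lemma polyIntegral_pderiv {q : ℕ} {Q : MvPolynomial (Fin (n + 1)) ℝ} (hQ : Q.IsHomogeneous q)
    (i : Fin (n + 1)) : polyIntegral n (pderiv i Q) = (q + n) * polyIntegral n (X i * Q) := by
  have hleft : ∑ j, X j * pderiv i (X j * Q) = X i * Q + normSqPoly n * pderiv i Q := by
    simp only [Derivation.leibniz, smul_eq_mul, pderiv_X, mul_add, Finset.sum_add_distrib,
      normSqPoly, Finset.sum_mul]
    have hsingle : ∑ j, X j * (Q * (Pi.single i 1 : _ → MvPolynomial _ ℝ) j) = X i * Q := by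
      rw [Finset.sum_eq_single i (fun j _ hj => by simp [hj]) (by simp), Pi.single_eq_same,
        mul_one]
    rw [hsingle, add_comm _ (X i * Q)]
    exact congrArg _ (Finset.sum_congr rfl fun j _ => by ring)
  have hright : ∑ j, X i * pderiv j (X j * Q) = ((q + n + 1 : ℕ) : ℝ) • (X i * Q) := by
    have heuler := hQ.sum_X_mul_pderiv
    simp only [Derivation.leibniz, smul_eq_mul, pderiv_X_self, mul_one, ← Finset.mul_sum,
      Finset.sum_add_distrib, heuler, Finset.sum_const, Finset.card_univ, Fintype.card_fin,
      ← add_smul]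
    rw [mul_smul_comm, Nat.cast_smul_eq_nsmul, add_assoc]
  have h : polyIntegral n (∑ j, X j * pderiv i (X j * Q)) =
      polyIntegral n (∑ j, X i * pderiv j (X j * Q)) := by
    simp only [map_sum, polyIntegral_X_mul_pderiv_comm i _ (_ * Q)]
  rw [hleft, hright, map_add, polyIntegral_normSqPoly_mul, map_smul, smul_eq_mul] at h
  push_cast at h
  linear_combination h

lemma polyLaplacian_apply (Q : MvPolynomial (Fin (n + 1)) ℝ) :
    polyLaplacian n Q = ∑ i, pderiv i (pderiv i Q) := by
  simp [polyLaplacian]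

lemma polyLaplacian_isHomogeneous {d : ℕ} {Q : MvPolynomial (Fin (n + 1)) ℝ}
    (hQ : Q.IsHomogeneous (d + 2)) : (polyLaplacian n Q).IsHomogeneous d := by
  rw [polyLaplacian_apply]
  exact .sum _ _ _ fun i _ => hQ.pderiv.pderiv

lemma pderiv_eq_zero_of_isHomogeneous_zero {ι : Type*} {Q : MvPolynomial ι ℝ}
    (hQ : Q.IsHomogeneous 0) (i : ι) : pderiv i Q = 0 := by
  rw [totalDegree_eq_zero_iff_eq_C.1 ((totalDegree_zero_iff_isHomogeneous (p := Q)).2 hQ),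
    pderiv_C]

lemma polyLaplacian_eq_zero_of_lt {d : ℕ} {Q : MvPolynomial (Fin (n + 1)) ℝ}
    (hQ : Q.IsHomogeneous d) (hd : d < 2) : polyLaplacian n Q = 0 := by
  rw [polyLaplacian_apply]
  refine Finset.sum_eq_zero fun i _ => pderiv_eq_zero_of_isHomogeneous_zero ?_ i
  simpa [show d - 1 = 0 by omega] using hQ.pderiv (i := i)

section Green

variable {p q : ℕ} {A B : MvPolynomial (Fin (n + 1)) ℝ}

lemma polyIntegral_mul_laplacian (hA : A.IsHomogeneous p) (hB : B.IsHomogeneous q) :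
    polyIntegral n (B * polyLaplacian n A) + ∑ i, polyIntegral n (pderiv i B * pderiv i A) =
      (p + q + n - 1) * p * polyIntegral n (A * B) := by
  rw [polyLaplacian_apply, Finset.mul_sum, map_sum, ← Finset.sum_add_distrib]
  obtain rfl | hp := Nat.eq_zero_or_pos p
  · simp [pderiv_eq_zero_of_isHomogeneous_zero hA]
  have hpart (i : Fin (n + 1)) : polyIntegral n (B * pderiv i (pderiv i A)) +
      polyIntegral n (pderiv i B * pderiv i A) =
        (p + q + n - 1) * polyIntegral n (B * (X i * pderiv i A)) := by
    have h := polyIntegral_pderiv (hB.mul (hA.pderiv (i := i))) i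
    rw [(pderiv i).leibniz, smul_eq_mul, smul_eq_mul, map_add, mul_comm (pderiv i A),
      mul_left_comm (X i) B, Nat.cast_add, Nat.cast_sub hp] at h
    rw [h]
    push_cast
    ring
  rw [Finset.sum_congr rfl fun i _ => hpart i, ← Finset.mul_sum, ← map_sum, ← Finset.mul_sum,
    hA.sum_X_mul_pderiv, mul_smul_comm, map_nsmul, mul_comm B A, nsmul_eq_mul, mul_assoc]

theorem polyIntegral_green (hA : A.IsHomogeneous p) (hB : B.IsHomogeneous q) :
    polyIntegral n (B * polyLaplacian n A) - polyIntegral n (A * polyLaplacian n B) =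
      ((p : ℝ) + q + n - 1) * (p - q) * polyIntegral n (A * B) := by
  have hAB := polyIntegral_mul_laplacian hA hB
  have hBA := polyIntegral_mul_laplacian hB hA
  simp only [mul_comm (pderiv _ A), mul_comm B A] at hBA
  linear_combination hAB - hBA

lemma polyIntegral_mul_harmonic_eq_zero (hA : A.IsHomogeneous p) (hA0 : polyLaplacian n A = 0)
    (hq : q < p) (hB : B.IsHomogeneous q) : polyIntegral n (A * B) = 0 := by
  induction q using Nat.strong_induction_on generalizing B with
  | _ q ih =>
    by_cases hpq : p + q = 1
    · exact polyIntegral_eq_zero_of_odd (by simp [hpq]) (hA.mul hB)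
    have hlap : polyIntegral n (A * polyLaplacian n B) = 0 := by
      by_cases h2 : q < 2
      · simp [polyLaplacian_eq_zero_of_lt hB h2]
      · obtain ⟨d, rfl⟩ := Nat.exists_eq_add_of_le' (not_lt.1 h2)
        exact ih d (by omega) (by omega) (polyLaplacian_isHomogeneous hB)
    have h := polyIntegral_green hA hB
    rw [hA0, hlap, mul_zero, map_zero, sub_zero] at h
    have hsum : (2 : ℝ) ≤ p + q := by exact_mod_cast (by omega : 2 ≤ p + q)
    have hqp : (q : ℝ) < p := by exact_mod_cast hq
    have : (0 : ℝ) ≤ n := n.cast_nonneg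
    exact (mul_eq_zero.1 h.symm).resolve_left (mul_ne_zero (by linarith) (by linarith))

end Green

lemma integral_pos_of_continuous_of_ne {X : Type*} [TopologicalSpace X] [CompactSpace X]
    [MeasurableSpace X] [OpensMeasurableSpace X] {μ : Measure X} [IsFiniteMeasureOnCompacts μ]
    [μ.IsOpenPosMeasure] {f : X → ℝ} (hf : Continuous f) (h0 : ∀ x, 0 ≤ f x) {x₀ : X}
    (h : f x₀ ≠ 0) : 0 < ∫ x, f x ∂μ :=
  hf.integral_pos_of_hasCompactSupport_nonneg_nonzero (.of_compactSpace _) h0 h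

instance (n : ℕ) : Nonempty (Sph n) := ⟨⟨EuclideanSpace.single 0 1, by simp⟩⟩

lemma exists_eq_norm_smul_sphere (x : Eu n) : ∃ ω : Sph n, x = ‖x‖ • (ω : Eu n) := by
  by_cases hx : x = 0
  · exact ⟨Classical.arbitrary _, by simp [hx]⟩
  · have h : ‖x‖ ≠ 0 := norm_ne_zero_iff.2 hx
    exact ⟨⟨‖x‖⁻¹ • x, by simp [norm_smul, h]⟩, by simp [smul_smul, h]⟩

lemma eq_zero_of_polyIntegral_mul_self {d : ℕ} {A : MvPolynomial (Fin (n + 1)) ℝ}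
    (hA : A.IsHomogeneous d) (h : polyIntegral n (A * A) = 0) : A = 0 := by
  have hsphere (ω : Sph n) : restrictPoly n A ω = 0 := by
    by_contra hω
    refine (integral_pos_of_continuous_of_ne (μ := surf n) (map_continuous (restrictPoly n (A * A)))
      (fun ω => ?_) (x₀ := ω) ?_).ne' h
    · rw [restrictPoly_mul]; exact mul_self_nonneg _
    · rw [restrictPoly_mul]; exact mul_ne_zero hω hω
  refine MvPolynomial.funext fun x => ?_
  obtain ⟨ω, hω⟩ := exists_eq_norm_smul_sphere (WithLp.toLp 2 x)
  have hx : x = ‖(WithLp.toLp 2 x : Eu n)‖ • ((ω : Eu n) : Fin (n + 1) → ℝ) :=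
    congrArg WithLp.ofLp hω
  rw [hx, eval_smul_of_isHomogeneous hA, ← restrictPoly_apply, hsphere, mul_zero, map_zero]

/- `B ↦ Δ(|x|² B)` is injective on homogeneous polynomials of degree `d`: if `|x|² B` is harmonic,
then it is orthogonal to `B` on the sphere. Hence it is surjective. -/
lemma exists_polyLaplacian_sub_normSqPoly_mul_eq_zero {d : ℕ}
    {A : MvPolynomial (Fin (n + 1)) ℝ} (hA : A.IsHomogeneous (d + 2)) :
    ∃ B : MvPolynomial (Fin (n + 1)) ℝ, B.IsHomogeneous d ∧
      polyLaplacian n (A - normSqPoly n * B) = 0 := by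
  let V := homogeneousSubmodule (Fin (n + 1)) ℝ d
  have : FiniteDimensional ℝ V := Module.Finite.iff_fg.mpr (homogeneousSubmodule_fg _ _ d)
  have hmul (B : MvPolynomial (Fin (n + 1)) ℝ) (hB : B ∈ V) :
      (normSqPoly n * B).IsHomogeneous (d + 2) :=
    add_comm d 2 ▸ (normSqPoly_isHomogeneous n).mul hB
  let L : V →ₗ[ℝ] V := (polyLaplacian n ∘ₗ LinearMap.mulLeft ℝ (normSqPoly n)).restrict
    fun B hB => polyLaplacian_isHomogeneous (hmul B hB)
  have hL : Function.Injective L := by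
    rw [← LinearMap.ker_eq_bot, LinearMap.ker_eq_bot']
    rintro ⟨B, hB⟩ h
    have hharm : polyLaplacian n (normSqPoly n * B) = 0 := congrArg Subtype.val h
    have horth := polyIntegral_mul_harmonic_eq_zero (hmul B hB) hharm (by omega) hB
    rw [mul_assoc, polyIntegral_normSqPoly_mul] at horth
    exact Subtype.ext (eq_zero_of_polyIntegral_mul_self hB horth)
  obtain ⟨⟨B, hB⟩, h⟩ := LinearMap.injective_iff_surjective.1 hL
    ⟨polyLaplacian n A, polyLaplacian_isHomogeneous hA⟩
  have hlap : polyLaplacian n (normSqPoly n * B) = polyLaplacian n A := congrArg Subtype.val h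
  exact ⟨B, hB, by rw [map_sub, hlap, sub_self]⟩

lemma toL2_restrictPoly_mem_sphericalHarmonics {ℓ : ℕ} {A : MvPolynomial (Fin (n + 1)) ℝ}
    (hA : A.IsHomogeneous ℓ) (hA0 : polyLaplacian n A = 0) :
    toL2 n (restrictPoly n A) ∈ sphericalHarmonics n ℓ :=
  ⟨A, ⟨hA, hA0⟩, rfl⟩

lemma toL2_restrictPoly_mem_iSup_of_isHomogeneous {d : ℕ} {A : MvPolynomial (Fin (n + 1)) ℝ}
    (hA : A.IsHomogeneous d) : toL2 n (restrictPoly n A) ∈ ⨆ ℓ, sphericalHarmonics n ℓ := by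
  induction d using Nat.strong_induction_on generalizing A with
  | _ d ih =>
    by_cases hd : d < 2
    · exact Submodule.mem_iSup_of_mem d
        (toL2_restrictPoly_mem_sphericalHarmonics hA (polyLaplacian_eq_zero_of_lt hA hd))
    · obtain ⟨d, rfl⟩ := Nat.exists_eq_add_of_le' (not_lt.1 hd)
      obtain ⟨B, hB, h⟩ := exists_polyLaplacian_sub_normSqPoly_mul_eq_zero hA
      have hmul : (normSqPoly n * B).IsHomogeneous (d + 2) :=
        add_comm d 2 ▸ (normSqPoly_isHomogeneous n).mul hB
      have hsplit : toL2 n (restrictPoly n A) =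
          toL2 n (restrictPoly n (A - normSqPoly n * B)) + toL2 n (restrictPoly n B) := by
        rw [← map_add, map_sub, restrictPoly_mul, restrictPoly_normSqPoly, one_mul,
          sub_add_cancel]
      rw [hsplit]
      exact add_mem (Submodule.mem_iSup_of_mem (d + 2)
        (toL2_restrictPoly_mem_sphericalHarmonics (hA.sub hmul) h)) (ih d (by omega) hB)

lemma toL2_restrictPoly_mem_iSup (A : MvPolynomial (Fin (n + 1)) ℝ) :
    toL2 n (restrictPoly n A) ∈ ⨆ ℓ, sphericalHarmonics n ℓ := by
  rw [← sum_homogeneousComponent A, map_sum, map_sum]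
  exact sum_mem fun d _ =>
    toL2_restrictPoly_mem_iSup_of_isHomogeneous (homogeneousComponent_isHomogeneous d A)

lemma denseRange_restrictPoly (n : ℕ) : DenseRange (restrictPoly n) := by
  let S : Subalgebra ℝ C(Sph n, ℝ) :=
    { LinearMap.range (restrictPoly n) with
      mul_mem' := by
        rintro _ _ ⟨p, rfl⟩ ⟨q, rfl⟩
        exact ⟨p * q, restrictPoly_mul p q⟩
      algebraMap_mem' := fun r => ⟨C r, by ext; simp [restrictPoly_apply]⟩ }
  have hS : S.SeparatesPoints := by
    intro x y hxy
    obtain ⟨i, hi⟩ : ∃ i, (x : Eu n) i ≠ (y : Eu n) i := by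
      by_contra! h
      exact hxy (Subtype.ext (PiLp.ext h))
    exact ⟨_, ⟨restrictPoly n (X i), ⟨X i, rfl⟩, rfl⟩, by simpa [restrictPoly_apply] using hi⟩
  have htop := ContinuousMap.subalgebra_topologicalClosure_eq_top_of_separatesPoints S hS
  intro f
  exact show f ∈ S.topologicalClosure from htop ▸ trivial

lemma topologicalClosure_iSup_sphericalHarmonics (n : ℕ) :
    (⨆ ℓ, sphericalHarmonics n ℓ).topologicalClosure = ⊤ := by
  have hcont : DenseRange (toL2 n) := ContinuousMap.toLp_denseRange ℝ (surf n) ℝ (by simp)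
  have hpoly : DenseRange (toL2 n ∘ restrictPoly n) :=
    hcont.comp (denseRange_restrictPoly n) (toL2 n).continuous
  rw [eq_top_iff]
  rintro u -
  refine closure_mono ?_ (hpoly u)
  rintro _ ⟨A, rfl⟩
  exact toL2_restrictPoly_mem_iSup A

lemma inner_toL2 (f g : C(Sph n, ℝ)) :
    inner ℝ (toL2 n f) (toL2 n g) = ∫ ω, f ω * g ω ∂surf n := by
  rw [toL2, ContinuousMap.inner_toLp]
  simp [mul_comm]

lemma inner_toL2_restrictPoly (A B : MvPolynomial (Fin (n + 1)) ℝ) :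
    inner ℝ (toL2 n (restrictPoly n A)) (toL2 n (restrictPoly n B)) = polyIntegral n (A * B) := by
  rw [inner_toL2]
  change _ = ∫ ω, restrictPoly n (A * B) ω ∂surf n
  rw [restrictPoly_mul]
  rfl

lemma orthogonalFamily_sphericalHarmonics (n : ℕ) :
    OrthogonalFamily ℝ (fun ℓ => sphericalHarmonics n ℓ)
      fun ℓ => (sphericalHarmonics n ℓ).subtypeₗᵢ := by
  rintro i j hij ⟨_, A, ⟨hA, hA0⟩, rfl⟩ ⟨_, B, ⟨hB, hB0⟩, rfl⟩
  change inner ℝ (toL2 n (restrictPoly n A)) (toL2 n (restrictPoly n B)) = 0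
  rw [inner_toL2_restrictPoly]
  obtain h | h := hij.lt_or_gt
  · rw [mul_comm]
    exact polyIntegral_mul_harmonic_eq_zero hB hB0 h hA
  · exact polyIntegral_mul_harmonic_eq_zero hA hA0 h hB

theorem isHilbertSum_sphericalHarmonics (n : ℕ) :
    IsHilbertSum ℝ (fun ℓ => sphericalHarmonics n ℓ)
      fun ℓ => (sphericalHarmonics n ℓ).subtypeₗᵢ :=
  .mkInternal _ (orthogonalFamily_sphericalHarmonics n)
    (topologicalClosure_iSup_sphericalHarmonics n).ge

lemma P_eq_linearIsometryEquiv (u : L2 n) (ℓ : ℕ) :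
    P n ℓ u = ((isHilbertSum_sphericalHarmonics n).linearIsometryEquiv u ℓ : L2 n) := by
  set hV := isHilbertSum_sphericalHarmonics n
  set w := hV.linearIsometryEquiv u with hw
  have hu := hV.hasSum_linearIsometryEquiv_symm w
  rw [hw, LinearIsometryEquiv.symm_apply_apply, ← hw] at hu
  refine (hu.mapL (P n ℓ)).unique ?_
  have hproj : P n ℓ (w ℓ : L2 n) = w ℓ := Submodule.starProjection_eq_self_iff.2 (w ℓ).2
  have hsingle := hasSum_single
    (f := fun i => P n ℓ ((sphericalHarmonics n i).subtypeₗᵢ (w i))) ℓ fun j hj =>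
      (Submodule.starProjection_apply_eq_zero_iff _).2 fun v hv =>
        orthogonalFamily_sphericalHarmonics n hj.symm ⟨v, hv⟩ (w j)
  simpa [hproj] using hsingle

theorem hasSum_inner_P (u v : L2 n) :
    HasSum (fun ℓ => inner ℝ (P n ℓ u) (P n ℓ v)) (inner ℝ u v) := by
  let Φ := (isHilbertSum_sphericalHarmonics n).linearIsometryEquiv
  have h := lp.hasSum_inner (𝕜 := ℝ) (Φ u) (Φ v)
  rw [LinearIsometryEquiv.inner_map_map] at h
  simp only [P_eq_linearIsometryEquiv]
  exact h

lemma P_eq_iff {ℓ : ℕ} (u v : L2 n) :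
    P n ℓ u = P n ℓ v ↔ ∀ A : MvPolynomial (Fin (n + 1)) ℝ, A.IsHomogeneous ℓ →
      polyLaplacian n A = 0 →
        inner ℝ (toL2 n (restrictPoly n A)) u = inner ℝ (toL2 n (restrictPoly n A)) v := by
  rw [← sub_eq_zero, ← map_sub, P, Submodule.starProjection_apply_eq_zero_iff]
  simp only [← sub_eq_zero (a := inner ℝ _ u), ← inner_sub_right]
  refine ⟨fun h A hA hA0 => h _ (toL2_restrictPoly_mem_sphericalHarmonics hA hA0), ?_⟩
  rintro h _ ⟨A, ⟨hA, hA0⟩, rfl⟩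
  exact h A hA hA0

end SphericalHarmonics

section KernelIntegral

open MvPolynomial

lemma integral_mul_pow_le_norm {X : Type*} [TopologicalSpace X] [CompactSpace X]
    (f g : C(X, ℝ)) (c : ℝ) (k : ℕ) (x : X) :
    ‖f x * (c * g x ^ k)‖ ≤ ‖f‖ * (|c| * ‖g‖ ^ k) := by
  rw [norm_mul, norm_mul, norm_pow, Real.norm_eq_abs c]
  gcongr
  · exact f.norm_coe_le_norm x
  · exact g.norm_coe_le_norm x

lemma hasSum_integral_mul_one_sub_rpow {X : Type*} [TopologicalSpace X] [CompactSpace X]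
    [MeasurableSpace X] [OpensMeasurableSpace X] {μ : Measure X} [IsFiniteMeasure μ]
    (f : C(X, ℝ)) {g : C(X, ℝ)} (hg : ‖g‖ < 1) (κ : ℝ) :
    HasSum (fun k => PowerSeries.coeff k (oneSubPow κ) * ∫ x, f x * g x ^ k ∂μ)
      (∫ x, f x * (1 - g x) ^ κ ∂μ) := by
  have hg' : |‖g‖| < 1 := by rwa [abs_norm]
  have hsum : Summable fun k => ‖f‖ * (|PowerSeries.coeff k (oneSubPow κ)| * ‖g‖ ^ k) := by
    simpa [abs_mul] using (hasSum_oneSubPow κ hg').summable.abs.mul_left ‖f‖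
  have h := hasSum_integral_of_dominated_convergence (μ := μ)
    (F := fun k x => f x * (PowerSeries.coeff k (oneSubPow κ) * g x ^ k))
    (f := fun x => f x * (1 - g x) ^ κ) _
    (fun k => (by fun_prop : Continuous _).aestronglyMeasurable)
    (fun k => .of_forall fun x => integral_mul_pow_le_norm f g _ k x)
    (.of_forall fun _ => hsum) (integrable_const _)
    (.of_forall fun x =>
      (hasSum_oneSubPow κ ((g.norm_coe_le_norm x).trans_lt hg)).mul_left (f x))
  refine h.congr_fun fun k => ?_
  rw [← integral_const_mul]
  exact integral_congr_ae (.of_forall fun x => by ring)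

variable {n : ℕ}

/-- The linear form `x ↦ ζ · x` as a polynomial. -/
def linPoly (ζ : Eu n) : MvPolynomial (Fin (n + 1)) ℝ := ∑ i, C (ζ i) * X i

lemma linPoly_pow_isHomogeneous (ζ : Eu n) (k : ℕ) : (linPoly ζ ^ k).IsHomogeneous k := by
  have h : (linPoly ζ).IsHomogeneous 1 := .sum _ _ _ fun i _ => isHomogeneous_C_mul_X _ i
  simpa using h.pow k

lemma restrictPoly_linPoly (ζ : Eu n) (ω : Sph n) :
    restrictPoly n (linPoly ζ) ω = inner ℝ ζ (ω : Eu n) := by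
  simp [restrictPoly_apply, linPoly, PiLp.inner_apply, mul_comm]

lemma restrictPoly_pow (Q : MvPolynomial (Fin (n + 1)) ℝ) (k : ℕ) :
    restrictPoly n (Q ^ k) = restrictPoly n Q ^ k := by
  ext ω
  simp [restrictPoly_apply]

lemma abs_inner_le_norm_left (ζ : Eu n) (ω : Sph n) : |inner ℝ ζ (ω : Eu n)| ≤ ‖ζ‖ := by
  simpa using abs_real_inner_le_norm ζ (ω : Eu n)

lemma norm_restrictPoly_linPoly_le (ζ : Eu n) : ‖restrictPoly n (linPoly ζ)‖ ≤ ‖ζ‖ :=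
  (ContinuousMap.norm_le _ (norm_nonneg ζ)).2 fun ω => by
    simpa [restrictPoly_linPoly] using abs_inner_le_norm_left ζ ω

lemma pderiv_linPoly (ζ : Eu n) (i : Fin (n + 1)) : pderiv i (linPoly ζ) = C (ζ i) := by
  rw [linPoly, map_sum, Finset.sum_eq_single i (fun j _ hj => by simp [pderiv_X, hj]) (by simp)]
  simp

lemma polyLaplacian_linPoly_pow (ζ : Eu n) (k : ℕ) :
    polyLaplacian n (linPoly ζ ^ (k + 2)) =
      ((k + 2 : ℝ) * (k + 1) * ‖ζ‖ ^ 2) • linPoly ζ ^ k := by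
  have hpderiv (i : Fin (n + 1)) : pderiv i (pderiv i (linPoly ζ ^ (k + 2))) =
      ((k + 2 : ℝ) * (k + 1) * (ζ i) ^ 2) • linPoly ζ ^ k := by
    rw [pderiv_pow, pderiv_linPoly, (pderiv i).leibniz, pderiv_C, smul_zero, zero_add,
      (pderiv i).leibniz, Derivation.map_natCast]
    simp only [show k + 2 - 1 = k + 1 by omega, pderiv_pow, pderiv_linPoly, Nat.add_sub_cancel,
      smul_eq_mul, smul_eq_C_mul]
    push_cast
    simp only [map_mul, map_add, map_pow, map_natCast, map_ofNat, map_one]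
    ring
  rw [polyLaplacian_apply, Finset.sum_congr rfl fun i _ => hpderiv i, ← Finset.sum_smul,
    ← Finset.mul_sum, EuclideanSpace.norm_sq_eq]
  simp

/-- The moment `∫ A(ω) (ζ · ω)ᵏ`. -/
def moment (A : MvPolynomial (Fin (n + 1)) ℝ) (ζ : Eu n) (k : ℕ) : ℝ :=
  polyIntegral n (A * linPoly ζ ^ k)

lemma hasSum_moment (A : MvPolynomial (Fin (n + 1)) ℝ) {ζ : Eu n} (hζ : ‖ζ‖ < 1) (κ : ℝ) :
    HasSum (fun k => PowerSeries.coeff k (oneSubPow κ) * moment A ζ k)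
      (∫ ω : Sph n, restrictPoly n A ω * (1 - inner ℝ ζ (ω : Eu n)) ^ κ ∂surf n) := by
  have hmoment (k : ℕ) : moment A ζ k =
      ∫ ω : Sph n, restrictPoly n A ω * restrictPoly n (linPoly ζ) ω ^ k ∂surf n := by
    change ∫ ω : Sph n, restrictPoly n (A * linPoly ζ ^ k) ω ∂surf n = _
    simp only [restrictPoly_mul, restrictPoly_pow, ContinuousMap.mul_apply,
      ContinuousMap.pow_apply]
  simpa only [hmoment, restrictPoly_linPoly] using
    hasSum_integral_mul_one_sub_rpow (μ := surf n) (restrictPoly n A)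
      ((norm_restrictPoly_linPoly_le ζ).trans_lt hζ) κ

section Harmonic

variable {ℓ : ℕ} {A : MvPolynomial (Fin (n + 1)) ℝ}

lemma moment_add_two (hA : A.IsHomogeneous ℓ) (hA0 : polyLaplacian n A = 0) (ζ : Eu n) (k : ℕ) :
    ((k : ℝ) + 2 - ℓ) * (k + 1 + ℓ + n) * moment A ζ (k + 2) =
      (k + 2) * (k + 1) * ‖ζ‖ ^ 2 * moment A ζ k := by
  have h := polyIntegral_green hA (linPoly_pow_isHomogeneous ζ (k + 2))
  rw [hA0, polyLaplacian_linPoly_pow, mul_zero, map_zero, mul_smul_comm, map_smul,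
    smul_eq_mul] at h
  push_cast at h
  rw [moment, moment]
  linear_combination h

lemma moment_eq_zero_of_lt (hA : A.IsHomogeneous ℓ) (hA0 : polyLaplacian n A = 0) (ζ : Eu n)
    {k : ℕ} (hk : k < ℓ) : moment A ζ k = 0 :=
  polyIntegral_mul_harmonic_eq_zero hA hA0 hk (linPoly_pow_isHomogeneous ζ k)

lemma moment_eq_zero_of_odd (hA : A.IsHomogeneous ℓ) (ζ : Eu n) {k : ℕ} (hk : Odd (ℓ + k)) :
    moment A ζ k = 0 :=
  polyIntegral_eq_zero_of_odd hk (hA.mul (linPoly_pow_isHomogeneous ζ k))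

lemma coeff_oneSubPow_mul_moment (hA : A.IsHomogeneous ℓ) (hA0 : polyLaplacian n A = 0) (κ : ℝ)
    (ζ : Eu n) (j : ℕ) :
    PowerSeries.coeff (ℓ + 2 * j) (oneSubPow κ) * moment A ζ (ℓ + 2 * j) =
      PowerSeries.coeff ℓ (oneSubPow κ) * moment A ζ ℓ *
        (PowerSeries.coeff j (hypergeomSeries ((ℓ - κ) / 2) ((ℓ - κ + 1) / 2) (ℓ + (n + 1) / 2)) *
          (‖ζ‖ ^ 2) ^ j) := by
  have hc (k : ℕ) : (ℓ : ℝ) + (n + 1) / 2 + k ≠ 0 := by positivity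
  induction j with
  | zero => simp [-PowerSeries.coeff_zero_eq_constantCoeff, coeff_zero_hypergeomSeries]
  | succ j ih =>
    have hhyp := solvesHypergeomODE_iff.1
      (solvesHypergeomODE_hypergeomSeries (a := (ℓ - κ) / 2) (b := (ℓ - κ + 1) / 2) hc) j
    have hm := moment_add_two hA hA0 ζ (ℓ + 2 * j)
    have hk := coeff_succ_oneSubPow κ (ℓ + 2 * j)
    have hk1 := coeff_succ_oneSubPow κ (ℓ + 2 * j + 1)
    rw [show ℓ + 2 * (j + 1) = ℓ + 2 * j + 2 by ring]
    push_cast at hm hk hk1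
    have hne : (j + 1 : ℝ) * (ℓ + (n + 1) / 2 + j) * ((ℓ + 2 * j + 2) * (ℓ + 2 * j + 1)) ≠ 0 := by
      positivity
    refine mul_left_cancel₀ hne ?_
    linear_combination
      (ℓ + 2 * j + 2) * (ℓ + 2 * j + 1) / 4 *
          PowerSeries.coeff (ℓ + 2 * j + 2) (oneSubPow κ) * hm +
        (ℓ + 2 * j + 2) * (ℓ + 2 * j + 1) / 4 * ‖ζ‖ ^ 2 * moment A ζ (ℓ + 2 * j) *
          ((ℓ + 2 * j + 1) * hk1 + (ℓ + 2 * j + 1 - κ) * hk) +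
        (ℓ + 2 * j + 2) * (ℓ + 2 * j + 1) * ‖ζ‖ ^ 2 *
          (((ℓ - κ) / 2 + j) * ((ℓ - κ + 1) / 2 + j)) * ih -
        (ℓ + 2 * j + 2) * (ℓ + 2 * j + 1) * PowerSeries.coeff ℓ (oneSubPow κ) * moment A ζ ℓ *
          (‖ζ‖ ^ 2) ^ (j + 1) * hhyp

/- Only the moments of order `ℓ + 2 j` contribute to the binomial expansion of the kernel, and they
satisfy a hypergeometric recurrence by Green's formula. -/
theorem integral_harmonic_mul_kernel (hA : A.IsHomogeneous ℓ) (hA0 : polyLaplacian n A = 0)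
    (κ : ℝ) {ζ : Eu n} (hζ : ‖ζ‖ < 1) :
    ∫ ω : Sph n, restrictPoly n A ω * (1 - inner ℝ ζ (ω : Eu n)) ^ κ ∂surf n =
      PowerSeries.coeff ℓ (oneSubPow κ) * moment A ζ ℓ *
        ₂F₁ ((ℓ - κ) / 2) ((ℓ - κ + 1) / 2) (ℓ + (n + 1) / 2 : ℝ) (‖ζ‖ ^ 2) := by
  have hinj : Function.Injective fun j => ℓ + 2 * j := fun i j h => by simpa using h
  have hsupp (k : ℕ) (hk : k ∉ Set.range fun j => ℓ + 2 * j) :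
      PowerSeries.coeff k (oneSubPow κ) * moment A ζ k = 0 := by
    obtain hlt | hle := lt_or_ge k ℓ
    · rw [moment_eq_zero_of_lt hA hA0 ζ hlt, mul_zero]
    · obtain ⟨m, rfl⟩ := Nat.exists_eq_add_of_le hle
      have hm : Odd m := by
        by_contra h
        obtain ⟨j, rfl⟩ := even_iff_two_dvd.1 (Nat.not_odd_iff_even.1 h)
        exact hk ⟨j, rfl⟩
      rw [moment_eq_zero_of_odd hA ζ (by rw [← add_assoc]; exact Even.add_odd ⟨ℓ, rfl⟩ hm),
        mul_zero]
  have h := (hinj.hasSum_iff hsupp).2 (hasSum_moment A hζ κ)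
  have hζ2 : |‖ζ‖ ^ 2| < 1 := by
    rw [abs_of_nonneg (sq_nonneg _)]
    exact pow_lt_one₀ (norm_nonneg ζ) hζ two_ne_zero
  refine h.unique (((hasSum_hypergeomSeries _ _ _ hζ2).mul_left _).congr_fun fun j => ?_)
  exact coeff_oneSubPow_mul_moment hA hA0 κ ζ j

/- By Euler's transformation: replacing `κ` by `-n - κ` replaces the hypergeometric parameters
`a`, `b` by `c - b`, `c - a`. -/
theorem integral_harmonic_mul_kernel_neg (hA : A.IsHomogeneous ℓ) (hA0 : polyLaplacian n A = 0)
    (κ : ℝ) {ζ : Eu n} (hζ : ‖ζ‖ < 1) :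
    (ascPochhammer ℝ ℓ).eval (n + κ) *
        ∫ ω : Sph n, restrictPoly n A ω * (1 - inner ℝ ζ (ω : Eu n)) ^ κ ∂surf n =
      (ascPochhammer ℝ ℓ).eval (-κ) * ((1 - ‖ζ‖ ^ 2) ^ ((n : ℝ) / 2 + κ) *
        ∫ ω : Sph n, restrictPoly n A ω * (1 - inner ℝ ζ (ω : Eu n)) ^ (-n - κ) ∂surf n) := by
  have hζ2 : |‖ζ‖ ^ 2| < 1 := by
    rw [abs_of_nonneg (sq_nonneg _)]
    exact pow_lt_one₀ (norm_nonneg ζ) hζ two_ne_zero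
  have hc (k : ℕ) : (ℓ : ℝ) + (n + 1) / 2 + k ≠ 0 := by positivity
  rw [integral_harmonic_mul_kernel hA hA0 κ hζ, integral_harmonic_mul_kernel hA hA0 (-n - κ) hζ,
    ordinaryHypergeometric_euler _ _ hc hζ2, ordinaryHypergeometric,
    ordinaryHypergeometricSeries_symm, ← ordinaryHypergeometric]
  simp only [oneSubPow, PowerSeries.coeff_mk]
  rw [show (ℓ : ℝ) + (n + 1) / 2 - (ℓ - κ) / 2 - (ℓ - κ + 1) / 2 = n / 2 + κ by ring,
    show (ℓ : ℝ) + (n + 1) / 2 - (ℓ - κ + 1) / 2 = (ℓ - (-n - κ)) / 2 by ring,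
    show (ℓ : ℝ) + (n + 1) / 2 - (ℓ - κ) / 2 = (ℓ - (-n - κ) + 1) / 2 by ring,
    show -(-(n : ℝ) - κ) = n + κ by ring]
  ring

end Harmonic

end KernelIntegral

section GammaRatio

variable {x y : ℝ}

lemma Gamma_natCast_add (hx : ∀ k : ℕ, x ≠ -k) (m : ℕ) :
    Real.Gamma (m + x) = Real.Gamma x * (ascPochhammer ℝ m).eval x := by
  induction m with
  | zero => simp
  | succ m ih =>
    have hne : (m : ℝ) + x ≠ 0 := fun h => hx m (by linarith)
    rw [Nat.cast_succ, add_right_comm, Real.Gamma_add_one hne, ih, ascPochhammer_succ_eval]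
    ring

lemma prod_range_add_natCast (x : ℝ) (m : ℕ) :
    ∏ j ∈ Finset.range m, (x + j) = (ascPochhammer ℝ m).eval x := by
  induction m with
  | zero => simp
  | succ m ih => rw [Finset.prod_range_succ, ih, ascPochhammer_succ_eval]

lemma tendsto_rpow_mul_factorial_div_Gamma (hx : ∀ k : ℕ, x ≠ -k) :
    Filter.Tendsto (fun m : ℕ => (m : ℝ) ^ x * m.factorial / Real.Gamma (m + 1 + x))
      Filter.atTop (𝓝 1) := by
  have hΓ : Real.Gamma x ≠ 0 := Real.Gamma_ne_zero hx
  have h := (Real.GammaSeq_tendsto_Gamma x).div_const (Real.Gamma x)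
  rw [div_self hΓ] at h
  refine h.congr fun m => ?_
  rw [Real.GammaSeq, prod_range_add_natCast, ← Nat.cast_succ, Gamma_natCast_add hx]
  field_simp

theorem tendsto_Gamma_div_Gamma_div_rpow (hx : ∀ k : ℕ, x ≠ -k) (hy : ∀ k : ℕ, y ≠ -k) :
    Filter.Tendsto
      (fun m : ℕ => Real.Gamma (m + 1 + x) / Real.Gamma (m + 1 + y) / (m : ℝ) ^ (x - y))
      Filter.atTop (𝓝 1) := by
  have h := (tendsto_rpow_mul_factorial_div_Gamma hy).div
    (tendsto_rpow_mul_factorial_div_Gamma hx) one_ne_zero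
  rw [div_one] at h
  refine h.congr' ?_
  filter_upwards [Filter.eventually_gt_atTop 0] with m hm
  have hm' : (0 : ℝ) < m := by exact_mod_cast hm
  have hfac : (m.factorial : ℝ) ≠ 0 := by exact_mod_cast m.factorial_ne_zero
  have hxm := (Real.rpow_pos_of_pos hm' x).ne'
  have hym := (Real.rpow_pos_of_pos hm' y).ne'
  rw [Pi.div_apply, Real.rpow_sub hm']
  field_simp

end GammaRatio

lemma exists_forall_le_and_le_of_tendsto {u : ℕ → ℝ} {l : ℝ} (hu : ∀ m, 0 < u m) (hl : 0 < l)
    (h : Filter.Tendsto u Filter.atTop (𝓝 l)) :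
    ∃ c > 0, ∃ C, ∀ m, c ≤ u m ∧ u m ≤ C := by
  obtain ⟨C, hC⟩ := h.bddAbove_range
  obtain ⟨c', hc'⟩ := (h.inv₀ hl.ne').bddAbove_range
  have hc'pos : 0 < c' := (inv_pos.2 (hu 0)).trans_le (hc' ⟨0, rfl⟩)
  exact ⟨c'⁻¹, inv_pos.2 hc'pos, C, fun m =>
    ⟨(inv_le_comm₀ hc'pos (hu m)).2 (hc' ⟨m, rfl⟩), hC ⟨m, rfl⟩⟩⟩

section Eigenvalues

/-- The admissible exponents: `s - n/2 ∈ (0,1) ∪ (1,2)`. -/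
def Admissible (n : ℕ) (s : ℝ) : Prop :=
  s - n / 2 ∈ Set.Ioo (0 : ℝ) 1 ∪ Set.Ioo (1 : ℝ) 2

variable {n : ℕ} {s : ℝ}

namespace Admissible

lemma pos (hs : Admissible n s) : 0 < s - n / 2 := by
  rcases hs with h | h <;> linarith [h.1]

lemma lt_two (hs : Admissible n s) : s - n / 2 < 2 := by
  rcases hs with h | h <;> linarith [h.2]

lemma ne_natCast (hs : Admissible n s) (k : ℕ) : s - n / 2 ≠ k := by
  rintro h
  rw [Admissible, h] at hs
  rcases hs with ⟨h₁, h₂⟩ | ⟨h₁, h₂⟩ <;> norm_cast at h₁ h₂ <;> omega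

lemma upper_ne_neg_natCast (hs : Admissible n s) (k : ℕ) : n / 2 + s ≠ -(k : ℝ) := by
  have := hs.pos
  have : (0 : ℝ) ≤ n := n.cast_nonneg
  have : (0 : ℝ) ≤ k := k.cast_nonneg
  linarith

lemma lower_ne_neg_natCast (hs : Admissible n s) (k : ℕ) : n / 2 - s ≠ -(k : ℝ) :=
  fun h => hs.ne_natCast k (by linarith)

end Admissible

variable (hs : Admissible n s)
include hs

theorem α_mul_ascPochhammer (ℓ : ℕ) :
    α n s ℓ * (ascPochhammer ℝ ℓ).eval (n / 2 - s) =
      α n s 0 * (ascPochhammer ℝ ℓ).eval (n / 2 + s) := by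
  have hΓ := Real.Gamma_ne_zero hs.lower_ne_neg_natCast
  have hΓℓ : Real.Gamma (ℓ + (n / 2 - s)) ≠ 0 := by
    rw [← neg_neg (ℓ + (n / 2 - s))]
    refine Real.Gamma_ne_zero fun k h => hs.lower_ne_neg_natCast (ℓ + k) ?_
    push_cast
    linarith
  rw [α, α, Nat.cast_zero, zero_add, add_assoc, add_sub_assoc,
    div_mul_eq_mul_div, div_mul_eq_mul_div, div_eq_div_iff hΓℓ hΓ,
    Gamma_natCast_add hs.upper_ne_neg_natCast, Gamma_natCast_add hs.lower_ne_neg_natCast]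
  ring

lemma α_pos_of_two_le {ℓ : ℕ} (hℓ : 2 ≤ ℓ) : 0 < α n s ℓ := by
  have h2 : (2 : ℝ) ≤ ℓ := by exact_mod_cast hℓ
  have := hs.pos
  have := hs.lt_two
  have : (0 : ℝ) ≤ n := n.cast_nonneg
  exact div_pos (Real.Gamma_pos_of_pos (by linarith)) (Real.Gamma_pos_of_pos (by linarith))

lemma α_one_eq : α n s 1 * (n / 2 - s) = α n s 0 * (n / 2 + s) := by
  simpa using α_mul_ascPochhammer hs 1

lemma α_one_mul_pos : 0 < α n s 1 * (1 - (s - n / 2)) := by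
  have hβ := hs.pos
  have hβ2 := hs.lt_two
  have hβ1 : 1 - (s - n / 2) ≠ 0 := sub_ne_zero.2 (by simpa using (hs.ne_natCast 1).symm)
  have : (0 : ℝ) ≤ n := n.cast_nonneg
  have hα : α n s 1 * (1 - (s - n / 2)) =
      Real.Gamma (1 + n / 2 + s) * (1 - (s - n / 2)) ^ 2 / Real.Gamma (1 - (s - n / 2) + 1) := by
    rw [Real.Gamma_add_one hβ1, α, Nat.cast_one, show 1 + (n : ℝ) / 2 - s = 1 - (s - n / 2) by ring]
    field_simp
  rw [hα]
  exact div_pos (mul_pos (Real.Gamma_pos_of_pos (by linarith)) (by positivity))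
    (Real.Gamma_pos_of_pos (by linarith))

lemma α_zero_mul_neg : α n s 0 * (1 - (s - n / 2)) < 0 := by
  have hβ := hs.pos
  have : (0 : ℝ) ≤ n := n.cast_nonneg
  refine neg_of_mul_neg_left (b := n / 2 + s) ?_ (by linarith)
  nlinarith [α_one_eq hs, mul_pos hβ (α_one_mul_pos hs)]

lemma α_ne_zero (ℓ : ℕ) : α n s ℓ ≠ 0 := by
  rcases ℓ with _ | _ | ℓ
  · exact left_ne_zero_of_mul (α_zero_mul_neg hs).ne
  · exact left_ne_zero_of_mul (α_one_mul_pos hs).ne'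
  · exact (α_pos_of_two_le hs (by omega)).ne'

theorem exists_abs_α_bounds : ∃ c > 0, ∃ C, ∀ ℓ : ℕ,
    c * (1 + (ℓ : ℝ)) ^ (2 * s) ≤ |α n s ℓ| ∧ |α n s ℓ| ≤ C * (1 + (ℓ : ℝ)) ^ (2 * s) := by
  have hpow (ℓ : ℕ) : 0 < (1 + (ℓ : ℝ)) ^ (2 * s) := by positivity
  have hratio : Filter.Tendsto (fun m : ℕ => (m : ℝ) / (m + 2)) Filter.atTop (𝓝 1) :=
    tendsto_natCast_div_add_atTop 2
  have hlim : Filter.Tendsto (fun ℓ : ℕ => |α n s ℓ| / (1 + (ℓ : ℝ)) ^ (2 * s))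
      Filter.atTop (𝓝 1) := by
    rw [← Filter.tendsto_add_atTop_iff_nat 1]
    have h := (tendsto_Gamma_div_Gamma_div_rpow hs.upper_ne_neg_natCast
      hs.lower_ne_neg_natCast).abs.mul
      (hratio.rpow_const (p := 2 * s) (Or.inl one_ne_zero))
    rw [abs_one, Real.one_rpow, one_mul] at h
    refine h.congr' ?_
    filter_upwards [Filter.eventually_gt_atTop 0] with m hm
    have hm' : (0 : ℝ) < m := by exact_mod_cast hm
    have := Real.rpow_pos_of_pos hm' (2 * s)
    rw [α, Real.div_rpow hm'.le (by positivity), abs_div _ ((m : ℝ) ^ _),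
      show (n : ℝ) / 2 + s - (n / 2 - s) = 2 * s by ring, abs_of_pos this,
      Nat.cast_succ, add_assoc _ (n / 2 : ℝ), add_sub_assoc, show 1 + ((m : ℝ) + 1) = m + 2 by ring]
    field_simp
  obtain ⟨c, hc, C, h⟩ := exists_forall_le_and_le_of_tendsto
    (fun ℓ => div_pos (abs_pos.2 (α_ne_zero hs ℓ)) (hpow ℓ)) one_pos hlim
  exact ⟨c, hc, C, fun ℓ => ⟨(le_div_iff₀ (hpow ℓ)).1 (h ℓ).1, (div_le_iff₀ (hpow ℓ)).1 (h ℓ).2⟩⟩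

end Eigenvalues

section BilinForm

-- `Φ ∘ τ` is bijective, so some `v - τ e` lies in `ker Φ`, and subtracting `τ e` lowers the form.
theorem pos_of_orthogonal_of_neg {V W U : Type*} [AddCommGroup V] [Module ℝ V] [AddCommGroup W]
    [Module ℝ W] [FiniteDimensional ℝ W] [AddCommGroup U] [Module ℝ U] [FiniteDimensional ℝ U]
    {B : LinearMap.BilinForm ℝ V} (hB : B.IsSymm) (Φ : V →ₗ[ℝ] W) (τ : U →ₗ[ℝ] V)
    (hpos : ∀ v, v ≠ 0 → Φ v = 0 → 0 < B v v) (hneg : ∀ e, e ≠ 0 → B (τ e) (τ e) < 0)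
    (hdim : Module.finrank ℝ W ≤ Module.finrank ℝ U) {v : V} (hv : v ≠ 0)
    (hort : ∀ e, B v (τ e) = 0) : 0 < B v v := by
  have hinj : Function.Injective (Φ ∘ₗ τ) := by
    refine (injective_iff_map_eq_zero _).2 fun e he => by_contra fun he0 => ?_
    have hτe : τ e ≠ 0 := fun h => by simpa [h] using hneg e he0
    exact (hneg e he0).not_gt (hpos _ hτe he)
  obtain ⟨e, he⟩ := (LinearMap.injective_iff_surjective_of_finrank_eq_finrank
    (le_antisymm (LinearMap.finrank_le_finrank_of_injective hinj) hdim)).1 hinj (Φ v)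
  have hτ : B (τ e) (τ e) ≤ 0 := by
    rcases eq_or_ne e 0 with rfl | he0
    · simp
    · exact (hneg e he0).le
  have hne : v - τ e ≠ 0 := fun h => by
    obtain rfl : v = τ e := sub_eq_zero.1 h
    exact (hneg e (by rintro rfl; exact hv (map_zero τ))).ne (hort e)
  have h := hpos (v - τ e) hne (by rw [map_sub, ← he, LinearMap.comp_apply, sub_self])
  have hswap : B (τ e) v = 0 := by simpa only [hort, RingHom.id_apply] using hB.eq (τ e) v
  simp only [map_sub, LinearMap.sub_apply, hort, hswap] at h
  linarith

end BilinForm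

section SobolevForm

variable {n : ℕ} {s : ℝ}

/-- The space `H^s(𝕊ⁿ)` as a linear subspace of `L²(𝕊ⁿ)`. -/
def sobolev (n : ℕ) (s : ℝ) : Submodule ℝ (L2 n) where
  carrier := Hs n s
  zero_mem' := by simp [Hs]
  add_mem' {u v} hu hv := by
    refine Summable.of_nonneg_of_le (fun ℓ => by positivity) (fun ℓ => ?_)
      ((Summable.add hu hv).mul_left 2)
    rw [map_add, ← mul_add, mul_left_comm]
    gcongr
    exact (pow_le_pow_left₀ (norm_nonneg _) (norm_add_le _ _) 2).trans add_sq_le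
  smul_mem' c u hu := by
    refine (Summable.mul_left (c ^ 2) hu).congr fun ℓ => ?_
    rw [map_smul, norm_smul, mul_pow, Real.norm_eq_abs, sq_abs, mul_left_comm]

lemma summable_aBilin (hs : Admissible n s) {u v : L2 n} (hu : u ∈ Hs n s) (hv : v ∈ Hs n s) :
    Summable fun ℓ : ℕ => α n s ℓ * inner ℝ (P n ℓ u) (P n ℓ v) := by
  obtain ⟨_, -, C, hα⟩ := exists_abs_α_bounds hs
  refine Summable.of_norm_bounded ((Summable.add hu hv).mul_left C) fun ℓ => ?_
  rw [norm_mul, Real.norm_eq_abs, ← mul_add, ← mul_assoc]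
  refine mul_le_mul (hα ℓ).2 ?_ (norm_nonneg _) ((abs_nonneg _).trans (hα ℓ).2)
  refine (norm_inner_le_norm _ _).trans ?_
  nlinarith [two_mul_le_add_sq ‖P n ℓ u‖ ‖P n ℓ v‖, mul_nonneg (norm_nonneg (P n ℓ u))
    (norm_nonneg (P n ℓ v))]

/-- The form `a_{2s}` as a bilinear form on `H^s(𝕊ⁿ)`. -/
def aForm (hs : Admissible n s) : LinearMap.BilinForm ℝ (sobolev n s) :=
  LinearMap.mk₂ ℝ (fun u v => aBilin n s u v)
    (fun u v w => by
      simp only [aBilin, Submodule.coe_add, map_add, inner_add_left, mul_add]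
      exact (summable_aBilin hs u.2 w.2).tsum_add (summable_aBilin hs v.2 w.2))
    (fun c u v => by
      simp only [aBilin, Submodule.coe_smul, map_smul, real_inner_smul_left, mul_left_comm _ c,
        tsum_mul_left, smul_eq_mul])
    (fun u v w => by
      simp only [aBilin, Submodule.coe_add, map_add, inner_add_right, mul_add]
      exact (summable_aBilin hs u.2 v.2).tsum_add (summable_aBilin hs u.2 w.2))
    (fun c u v => by
      simp only [aBilin, Submodule.coe_smul, map_smul, real_inner_smul_right, mul_left_comm _ c,
        tsum_mul_left, smul_eq_mul])

lemma aForm_apply (hs : Admissible n s) (u v : sobolev n s) : aForm hs u v = aBilin n s u v := rfl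

lemma aForm_isSymm (hs : Admissible n s) : (aForm hs).IsSymm :=
  ⟨fun u v => tsum_congr fun ℓ => by rw [real_inner_comm]⟩

lemma aQuad_eq_aForm (hs : Admissible n s) (u : sobolev n s) : aQuad n s u = aForm hs u u := by
  simp only [aForm_apply, aQuad, aBilin, real_inner_self_eq_norm_sq]

lemma aForm_pos_of_P_eq_zero (hs : Admissible n s) {ℓ₀ : ℕ} (hℓ₀ : ∀ ℓ ≠ ℓ₀, 0 < α n s ℓ)
    {u : sobolev n s} (hu : u ≠ 0) (hP : P n ℓ₀ u = 0) : 0 < aForm hs u u := by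
  obtain ⟨ℓ, hℓ⟩ : ∃ ℓ, P n ℓ u ≠ 0 := by
    by_contra! h
    have hsum := hasSum_inner_P (u : L2 n) u
    simp only [h, inner_zero_left] at hsum
    exact hu (Subtype.ext (inner_self_eq_zero.1 (hsum.unique hasSum_zero)))
  refine (summable_aBilin hs u.2 u.2).tsum_pos (fun j => ?_) ℓ
    (mul_pos (hℓ₀ ℓ fun h => hℓ (h ▸ hP)) (real_inner_self_pos.2 hℓ))
  rcases eq_or_ne j ℓ₀ with rfl | hj
  · simp [hP]
  · exact mul_nonneg (hℓ₀ j hj).le real_inner_self_nonneg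

theorem aForm_pos_of_orthogonal (hs : Admissible n s) {ℓ₀ : ℕ} (hℓ₀ : ∀ ℓ ≠ ℓ₀, 0 < α n s ℓ)
    {U : Type*} [AddCommGroup U] [Module ℝ U] [FiniteDimensional ℝ U] (τ : U →ₗ[ℝ] sobolev n s)
    (hneg : ∀ e, e ≠ 0 → aForm hs (τ e) (τ e) < 0)
    (hdim : Module.finrank ℝ (sphericalHarmonics n ℓ₀) ≤ Module.finrank ℝ U)
    {ρ : sobolev n s} (hρ : ρ ≠ 0) (hort : ∀ e, aForm hs ρ (τ e) = 0) : 0 < aForm hs ρ ρ := by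
  refine pos_of_orthogonal_of_neg (aForm_isSymm hs)
    ((sphericalHarmonics n ℓ₀).orthogonalProjectionOnto.toLinearMap ∘ₗ (sobolev n s).subtype) τ
    (fun u hu hΦ => aForm_pos_of_P_eq_zero hs hℓ₀ hu ?_) hneg hdim hρ hort
  have hΦ' : (sphericalHarmonics n ℓ₀).orthogonalProjectionOnto (u : L2 n) = 0 := hΦ
  rw [P, Submodule.starProjection_apply, hΦ', Submodule.coe_zero]

lemma finrank_sphericalHarmonics_le_card {ℓ : ℕ} {ι : Type*} [Fintype ι]
    {A : ι → MvPolynomial (Fin (n + 1)) ℝ}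
    (hA : MvPolynomial.homogeneousSubmodule (Fin (n + 1)) ℝ ℓ ≤ Submodule.span ℝ (Set.range A)) :
    Module.finrank ℝ (sphericalHarmonics n ℓ) ≤ Fintype.card ι := by
  have hle : sphericalHarmonics n ℓ ≤ Submodule.span ℝ
      (Set.range fun i => toL2 n (restrictPoly n (A i))) := by
    refine (Submodule.map_mono (inf_le_left.trans hA)).trans_eq ?_
    rw [Submodule.map_span, ← Set.range_comp]
    rfl
  have := FiniteDimensional.span_of_finite ℝ
    (Set.finite_range fun i => toL2 n (restrictPoly n (A i)))
  exact (Submodule.finrank_mono hle).trans (finrank_range_le_card _)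

lemma finrank_sphericalHarmonics_zero_le (n : ℕ) :
    Module.finrank ℝ (sphericalHarmonics n 0) ≤ 1 :=
  finrank_sphericalHarmonics_le_card (ι := Unit) (A := fun _ => 1) <| by
    rw [MvPolynomial.homogeneousSubmodule_zero, Set.range_const, Submodule.one_eq_span]

lemma finrank_sphericalHarmonics_one_le (n : ℕ) :
    Module.finrank ℝ (sphericalHarmonics n 1) ≤ n + 1 := by
  simpa only [Fintype.card_fin] using
    finrank_sphericalHarmonics_le_card MvPolynomial.homogeneousSubmodule_one_eq_span_X.le

/-- `ξ` is the image of `η` under the operator with eigenvalue `α_{2s}(ℓ)` on the spherical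
harmonics of degree `ℓ`. -/
def IsImage (n : ℕ) (s : ℝ) (η ξ : L2 n) : Prop := ∀ ℓ, α n s ℓ • P n ℓ η = P n ℓ ξ

namespace IsImage

variable {η ξ η' ξ' : L2 n}

lemma add (h : IsImage n s η ξ) (h' : IsImage n s η' ξ') : IsImage n s (η + η') (ξ + ξ') :=
  fun ℓ => by rw [map_add, map_add, smul_add, h ℓ, h' ℓ]

lemma const_smul (c : ℝ) (h : IsImage n s η ξ) : IsImage n s (c • η) (c • ξ) :=
  fun ℓ => by rw [map_smul, map_smul, smul_comm, h ℓ]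

lemma mem_Hs (hs : Admissible n s) (h : IsImage n s η ξ) : η ∈ Hs n s := by
  obtain ⟨c, hc, C, hα⟩ := exists_abs_α_bounds hs
  have hξ : Summable fun ℓ => ‖P n ℓ ξ‖ ^ 2 := by
    simpa only [real_inner_self_eq_norm_sq] using (hasSum_inner_P ξ ξ).summable
  refine Summable.of_nonneg_of_le (fun ℓ => by positivity) (fun ℓ => ?_) (hξ.mul_left (c ^ 2)⁻¹)
  have hs0 : 0 ≤ 2 * s := by linarith [hs.pos, n.cast_nonneg (α := ℝ)]
  have hge : 1 ≤ (1 + (ℓ : ℝ)) ^ (2 * s) := Real.one_le_rpow (by simp) hs0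
  rw [← h ℓ, norm_smul, Real.norm_eq_abs, mul_pow, ← mul_assoc]
  gcongr
  rw [le_inv_mul_iff₀ (by positivity)]
  calc c ^ 2 * (1 + (ℓ : ℝ)) ^ (2 * s) ≤ c ^ 2 * ((1 + (ℓ : ℝ)) ^ (2 * s)) ^ 2 := by
        gcongr
        exact le_self_pow₀ hge two_ne_zero
    _ = (c * (1 + (ℓ : ℝ)) ^ (2 * s)) ^ 2 := by ring
    _ ≤ |α n s ℓ| ^ 2 := by gcongr; exact (hα ℓ).1

lemma aBilin_eq (h : IsImage n s η ξ) (u : L2 n) : aBilin n s u η = inner ℝ u ξ := by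
  rw [← (hasSum_inner_P u ξ).tsum_eq, aBilin]
  exact tsum_congr fun ℓ => by rw [← h ℓ, real_inner_smul_right]

end IsImage

end SobolevForm

section ConformalKernels

variable {n : ℕ} {ζ : Eu n}

lemma one_sub_inner_pos (hζ : ‖ζ‖ < 1) (ω : Sph n) : 0 < 1 - inner ℝ ζ (ω : Eu n) := by
  linarith [(le_abs_self _).trans (abs_inner_le_norm_left ζ ω)]

lemma one_sub_norm_sq_pos (hζ : ‖ζ‖ < 1) : 0 < 1 - ‖ζ‖ ^ 2 := by
  nlinarith [norm_nonneg ζ]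

/-- The function `ω ↦ (1 - ζ·ω) / √(1 - |ζ|²)`, the inverse of the conformal factor of the
conformal transformation of `𝕊ⁿ` associated with `ζ`. The normalization makes the Jacobian
`confFactor ζ ω ^ (-n)`. -/
def confFactor (ζ : Eu n) (ω : Sph n) : ℝ := (1 - inner ℝ ζ (ω : Eu n)) / √(1 - ‖ζ‖ ^ 2)

lemma confFactor_pos (hζ : ‖ζ‖ < 1) (ω : Sph n) : 0 < confFactor ζ ω :=
  div_pos (one_sub_inner_pos hζ ω) (Real.sqrt_pos.2 (one_sub_norm_sq_pos hζ))

lemma continuousOn_confFactor :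
    ContinuousOn (fun p : Eu n × Sph n => confFactor p.1 p.2) (Metric.ball 0 1 ×ˢ Set.univ) := by
  refine ContinuousOn.div (by fun_prop) (by fun_prop) fun p hp => ?_
  exact (Real.sqrt_pos.2 (one_sub_norm_sq_pos (mem_ball_zero_iff.1 hp.1))).ne'

/-- The continuous function `confFactor ζ ^ κ` on the sphere; it is set to `0` if `1 ≤ ‖ζ‖`. -/
def confPow (κ : ℝ) (ζ : Eu n) : C(Sph n, ℝ) :=
  if hζ : ‖ζ‖ < 1 then
    ⟨fun ω => confFactor ζ ω ^ κ, by
      refine Continuous.rpow_const ?_ fun ω => Or.inl (confFactor_pos hζ ω).ne'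
      unfold confFactor
      fun_prop⟩
  else 0

lemma confPow_apply (hζ : ‖ζ‖ < 1) (κ : ℝ) (ω : Sph n) : confPow κ ζ ω = confFactor ζ ω ^ κ := by
  rw [confPow, dif_pos hζ, ContinuousMap.coe_mk]

lemma confPow_pos (hζ : ‖ζ‖ < 1) (κ : ℝ) (ω : Sph n) : 0 < confPow κ ζ ω :=
  confPow_apply hζ κ ω ▸ Real.rpow_pos_of_pos (confFactor_pos hζ ω) κ

lemma one_sub_inner_rpow (hζ : ‖ζ‖ < 1) (κ : ℝ) (ω : Sph n) :
    (1 - inner ℝ ζ (ω : Eu n)) ^ κ = √(1 - ‖ζ‖ ^ 2) ^ κ * confPow κ ζ ω := by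
  have hq := Real.sqrt_pos.2 (one_sub_norm_sq_pos hζ)
  rw [confPow_apply hζ, ← Real.mul_rpow hq.le (confFactor_pos hζ ω).le, confFactor,
    mul_div_cancel₀ _ hq.ne']

lemma confPow_mul_confPow (hζ : ‖ζ‖ < 1) (κ μ : ℝ) :
    confPow κ ζ * confPow μ ζ = confPow (κ + μ) ζ := by
  ext ω
  simp only [ContinuousMap.mul_apply, confPow_apply hζ, Real.rpow_add (confFactor_pos hζ ω)]

lemma confPow_zero (hζ : ‖ζ‖ < 1) : confPow 0 ζ = 1 := by
  ext ω
  rw [confPow_apply hζ, Real.rpow_zero, ContinuousMap.one_apply]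

lemma continuousOn_confPow (κ : ℝ) :
    ContinuousOn (fun p : Eu n × Sph n => confPow κ p.1 p.2) (Metric.ball 0 1 ×ˢ Set.univ) := by
  refine (continuousOn_confFactor.rpow_const (p := κ) fun p hp =>
    Or.inl (confFactor_pos (mem_ball_zero_iff.1 hp.1) p.2).ne').congr fun p hp => ?_
  exact confPow_apply (mem_ball_zero_iff.1 hp.1) κ p.2

/-- The negative of the logarithmic derivative of `confFactor` with respect to `ζ`, in the
direction `e`; explicitly `ω ↦ (e·ω) / (1 - ζ·ω) - (ζ·e) / (1 - |ζ|²)`. -/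
def confField (ζ : Eu n) : Eu n →ₗ[ℝ] C(Sph n, ℝ) where
  toFun e := (√(1 - ‖ζ‖ ^ 2))⁻¹ • (restrictPoly n (linPoly e) * confPow (-1) ζ) -
    (inner ℝ ζ e / (1 - ‖ζ‖ ^ 2)) • 1
  map_add' e e' := by
    ext ω
    simp only [ContinuousMap.sub_apply, ContinuousMap.smul_apply, ContinuousMap.mul_apply,
      ContinuousMap.add_apply, ContinuousMap.one_apply, restrictPoly_linPoly, inner_add_left,
      inner_add_right, smul_eq_mul]
    ring
  map_smul' c e := by
    ext ω
    simp only [ContinuousMap.sub_apply, ContinuousMap.smul_apply, ContinuousMap.mul_apply,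
      ContinuousMap.one_apply, restrictPoly_linPoly, real_inner_smul_left, real_inner_smul_right,
      smul_eq_mul, RingHom.id_apply]
    ring

lemma confField_apply (hζ : ‖ζ‖ < 1) (e : Eu n) (ω : Sph n) :
    confField ζ e ω =
      inner ℝ e (ω : Eu n) / (1 - inner ℝ ζ (ω : Eu n)) - inner ℝ ζ e / (1 - ‖ζ‖ ^ 2) := by
  have hq := Real.sqrt_pos.2 (one_sub_norm_sq_pos hζ)
  have hω := one_sub_inner_pos hζ ω
  simp only [confField, LinearMap.coe_mk, AddHom.coe_mk, ContinuousMap.sub_apply,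
    ContinuousMap.smul_apply, ContinuousMap.mul_apply, ContinuousMap.one_apply,
    restrictPoly_linPoly, confPow_apply hζ, Real.rpow_neg_one, confFactor, smul_eq_mul]
  field_simp

lemma continuousOn_confField (e : Eu n) :
    ContinuousOn (fun p : Eu n × Sph n => confField p.1 e p.2)
      (Metric.ball 0 1 ×ˢ Set.univ) := by
  have h : ContinuousOn (fun p : Eu n × Sph n =>
      inner ℝ e (p.2 : Eu n) / (1 - inner ℝ p.1 (p.2 : Eu n)) - inner ℝ p.1 e / (1 - ‖p.1‖ ^ 2))
      (Metric.ball 0 1 ×ˢ Set.univ) := by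
    refine (ContinuousOn.div (by fun_prop) (by fun_prop) fun p hp => ?_).sub
      (ContinuousOn.div (by fun_prop) (by fun_prop) fun p hp => ?_)
    · exact (one_sub_inner_pos (mem_ball_zero_iff.1 hp.1) p.2).ne'
    · exact (one_sub_norm_sq_pos (mem_ball_zero_iff.1 hp.1)).ne'
  exact h.congr fun p hp => confField_apply (mem_ball_zero_iff.1 hp.1) e p.2

lemma eq_zero_of_confField_eq_zero (hζ : ‖ζ‖ < 1) {e : Eu n} (he : confField ζ e = 0) : e = 0 := by
  have h (ω : Sph n) : inner ℝ e (ω : Eu n) =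
      inner ℝ ζ e / (1 - ‖ζ‖ ^ 2) * (1 - inner ℝ ζ (ω : Eu n)) := by
    have hω := congrArg (fun f : C(Sph n, ℝ) => f ω) he
    simp only [confField_apply hζ, ContinuousMap.zero_apply] at hω
    exact (div_eq_iff (one_sub_inner_pos hζ ω).ne').1 (sub_eq_zero.1 hω)
  obtain ⟨ω, hω⟩ := exists_eq_norm_smul_sphere e
  have h₁ := h ω
  have h₂ := h (-ω)
  simp only [coe_neg_sphere, inner_neg_right] at h₂
  have h₃ : inner ℝ e (ω : Eu n) = 0 := by
    have hk : inner ℝ ζ e / (1 - ‖ζ‖ ^ 2) = 0 := by linarith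
    rw [h₁, hk, zero_mul]
  rw [← inner_self_eq_zero (𝕜 := ℝ)]
  nth_rewrite 2 [hω]
  rw [real_inner_smul_right, h₃, mul_zero]

lemma hasDerivAt_confFactor {z : ℝ → Eu n} {e : Eu n} {t : ℝ} (hz : HasDerivAt z e t)
    (ht : ‖z t‖ < 1) (ω : Sph n) :
    HasDerivAt (fun t => confFactor (z t) ω) (-(confField (z t) e ω * confFactor (z t) ω)) t := by
  have hq := one_sub_norm_sq_pos ht
  have hsqrt := Real.sqrt_pos.2 hq
  have hω := one_sub_inner_pos ht ω
  have hnum := (hz.inner ℝ (hasDerivAt_const t (ω : Eu n))).const_sub 1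
  have hden := (hz.norm_sq.const_sub 1).sqrt hq.ne'
  refine (hnum.div hden hsqrt.ne').congr_deriv ?_
  rw [inner_zero_right, zero_add, confField_apply ht, confFactor]
  field_simp
  rw [Real.sq_sqrt hq.le]
  ring

lemma hasDerivAt_confPow {z : ℝ → Eu n} {e : Eu n} {t : ℝ} (hz : HasDerivAt z e t)
    (ht : ‖z t‖ < 1) (κ : ℝ) (ω : Sph n) :
    HasDerivAt (fun t => confPow κ (z t) ω) (-κ * (confField (z t) e * confPow κ (z t)) ω) t := by
  have hpos := confFactor_pos ht ω
  have h := (hasDerivAt_confFactor hz ht ω).rpow_const (p := κ) (Or.inl hpos.ne')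
  refine (h.congr_deriv ?_).congr_of_eventuallyEq ?_
  · rw [ContinuousMap.mul_apply, confPow_apply ht, Real.rpow_sub_one hpos.ne']
    field_simp
  · filter_upwards [hz.continuousAt.norm.eventually_lt_const ht] with x hx
    exact confPow_apply hx κ ω

lemma hasDerivAt_add_smul (ζ e : Eu n) (t : ℝ) : HasDerivAt (fun t : ℝ => ζ + t • e) e t := by
  simpa using ((hasDerivAt_id' t).smul_const e).const_add ζ

lemma eventually_norm_add_smul_lt_one (hζ : ‖ζ‖ < 1) (e : Eu n) :
    ∀ᶠ t : ℝ in 𝓝 0, ‖ζ + t • e‖ < 1 :=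
  (hasDerivAt_add_smul ζ e 0).continuousAt.norm.eventually_lt_const (by simpa using hζ)

end ConformalKernels

section Intertwining

variable {n : ℕ} {s : ℝ} {ζ : Eu n}

lemma hasDerivAt_integral_confPow (f : C(Sph n, ℝ)) (κ : ℝ) (hζ : ‖ζ‖ < 1) (e : Eu n) :
    HasDerivAt (fun t : ℝ => ∫ ω, (f * confPow κ (ζ + t • e)) ω ∂surf n)
      (-κ * ∫ ω, (f * (confField ζ e * confPow κ ζ)) ω ∂surf n) 0 := by
  set U : Set ℝ := {t | ‖ζ + t • e‖ < 1}
  have hpair : ContinuousOn (fun p : ℝ × Sph n => (ζ + p.1 • e, p.2)) (U ×ˢ Set.univ) := by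
    fun_prop
  have hmaps : Set.MapsTo (fun p : ℝ × Sph n => (ζ + p.1 • e, p.2)) (U ×ˢ Set.univ)
      (Metric.ball 0 1 ×ˢ Set.univ) := fun p hp => ⟨mem_ball_zero_iff.2 hp.1, hp.2⟩
  have hfield := (continuousOn_confField e).comp hpair hmaps
  have hpow := (continuousOn_confPow κ).comp hpair hmaps
  have hf : ContinuousOn (fun p : ℝ × Sph n => f p.2) (U ×ˢ Set.univ) := by fun_prop
  have h := hasDerivAt_integral_of_continuousOn (μ := surf n) (t₀ := 0)
    (F := fun t ω => (f * confPow κ (ζ + t • e)) ω)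
    (F' := fun t ω => f ω * (-κ * (confField (ζ + t • e) e * confPow κ (ζ + t • e)) ω))
    (eventually_norm_add_smul_lt_one hζ e)
    (fun t _ => ContinuousMap.continuous _) (hf.mul ((hfield.mul hpow).const_mul (-κ)))
    (fun t ht ω => (hasDerivAt_confPow (hasDerivAt_add_smul ζ e t) ht κ ω).const_mul (f ω))
  refine h.congr_deriv ?_
  rw [← integral_const_mul]
  simp only [zero_smul, add_zero, ContinuousMap.mul_apply]
  exact integral_congr_ae (Filter.Eventually.of_forall fun ω => by ring)

lemma integral_harmonic_mul_confPow {ℓ : ℕ} {A : MvPolynomial (Fin (n + 1)) ℝ}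
    (hA : A.IsHomogeneous ℓ) (hA0 : polyLaplacian n A = 0) (κ : ℝ) (hζ : ‖ζ‖ < 1) :
    (ascPochhammer ℝ ℓ).eval (n + κ) * ∫ ω, (restrictPoly n A * confPow κ ζ) ω ∂surf n =
      (ascPochhammer ℝ ℓ).eval (-κ) *
        ∫ ω, (restrictPoly n A * confPow (-n - κ) ζ) ω ∂surf n := by
  have hq := one_sub_norm_sq_pos hζ
  have hI (μ : ℝ) : ∫ ω, (restrictPoly n A * confPow μ ζ) ω ∂surf n =
      (1 - ‖ζ‖ ^ 2) ^ (-μ / 2) *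
        ∫ ω : Sph n, restrictPoly n A ω * (1 - inner ℝ ζ (ω : Eu n)) ^ μ ∂surf n := by
    rw [← integral_const_mul]
    refine integral_congr_ae (Filter.Eventually.of_forall fun ω => ?_)
    have hsqrt : (1 - ‖ζ‖ ^ 2) ^ (-μ / 2) * √(1 - ‖ζ‖ ^ 2) ^ μ = 1 := by
      rw [Real.sqrt_eq_rpow, ← Real.rpow_mul hq.le, ← Real.rpow_add hq]
      ring_nf
      exact Real.rpow_zero _
    simp only [ContinuousMap.mul_apply, one_sub_inner_rpow hζ]
    linear_combination -(restrictPoly n A ω * confPow μ ζ ω) * hsqrt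
  have hpow : (1 - ‖ζ‖ ^ 2) ^ (-(-n - κ) / 2) =
      (1 - ‖ζ‖ ^ 2) ^ (-κ / 2) * (1 - ‖ζ‖ ^ 2) ^ ((n : ℝ) / 2 + κ) := by
    rw [← Real.rpow_add hq]
    ring_nf
  rw [hI, hI, hpow]
  linear_combination (1 - ‖ζ‖ ^ 2) ^ (-κ / 2) * integral_harmonic_mul_kernel_neg hA hA0 κ hζ

lemma integral_confPow (κ : ℝ) (hζ : ‖ζ‖ < 1) :
    ∫ ω, confPow κ ζ ω ∂surf n = ∫ ω, confPow (-n - κ) ζ ω ∂surf n := by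
  have h := integral_harmonic_mul_confPow (MvPolynomial.isHomogeneous_one _ ℝ)
    (by simp [polyLaplacian]) κ hζ
  have h1 : restrictPoly n 1 = 1 := by ext ω; simp [restrictPoly_apply]
  simpa only [ascPochhammer_zero, Polynomial.eval_one, one_mul, h1] using h

lemma integral_confPow_neg_natCast (hζ : ‖ζ‖ < 1) :
    ∫ ω, confPow (-n) ζ ω ∂surf n = (surf n).real Set.univ := by
  have h := integral_confPow 0 hζ
  rw [sub_zero] at h
  rw [← h, confPow_zero hζ]
  simp only [ContinuousMap.one_apply, integral_const, smul_eq_mul, mul_one]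

lemma integral_confField_mul_confPow_neg_natCast (hn : n ≠ 0) (hζ : ‖ζ‖ < 1) (e : Eu n) :
    ∫ ω, (confField ζ e * confPow (-n) ζ) ω ∂surf n = 0 := by
  have h := hasDerivAt_integral_confPow 1 (-n) hζ e
  simp only [one_mul] at h
  have hconst := (hasDerivAt_const (0 : ℝ) ((surf n).real Set.univ)).congr_of_eventuallyEq
    ((eventually_norm_add_smul_lt_one hζ e).mono fun t ht => integral_confPow_neg_natCast ht)
  exact (mul_eq_zero.1 (h.unique hconst)).resolve_left (by simpa using hn)

lemma isImage_toL2_iff (f g : C(Sph n, ℝ)) :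
    IsImage n s (toL2 n f) (toL2 n g) ↔ ∀ ℓ (A : MvPolynomial (Fin (n + 1)) ℝ), A.IsHomogeneous ℓ →
      polyLaplacian n A = 0 → α n s ℓ * ∫ ω, (restrictPoly n A * f) ω ∂surf n =
        ∫ ω, (restrictPoly n A * g) ω ∂surf n := by
  refine forall_congr' fun ℓ => ?_
  rw [← map_smul, P_eq_iff]
  refine forall₃_congr fun A _ _ => ?_
  rw [real_inner_smul_right, inner_toL2, inner_toL2]
  rfl

lemma α_mul_integral_harmonic_mul_confPow (hs : Admissible n s) {ℓ : ℕ}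
    {A : MvPolynomial (Fin (n + 1)) ℝ} (hA : A.IsHomogeneous ℓ) (hA0 : polyLaplacian n A = 0)
    (hζ : ‖ζ‖ < 1) :
    α n s ℓ * ∫ ω, (restrictPoly n A * confPow (s - n / 2) ζ) ω ∂surf n =
      α n s 0 * ∫ ω, (restrictPoly n A * confPow (-(n / 2 + s)) ζ) ω ∂surf n := by
  have h := integral_harmonic_mul_confPow hA hA0 (s - n / 2) hζ
  rw [show (n : ℝ) + (s - n / 2) = n / 2 + s by ring, neg_sub,
    show (-n : ℝ) - (s - n / 2) = -(n / 2 + s) by ring] at h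
  have hpos : 0 < (n : ℝ) / 2 + s := by linarith [hs.pos, n.cast_nonneg (α := ℝ)]
  refine mul_left_cancel₀ (ascPochhammer_pos ℓ _ hpos).ne' ?_
  linear_combination α n s ℓ * h +
    (∫ ω, (restrictPoly n A * confPow (-(n / 2 + s)) ζ) ω ∂surf n) * α_mul_ascPochhammer hs ℓ

theorem isImage_confPow (hs : Admissible n s) (hζ : ‖ζ‖ < 1) :
    IsImage n s (toL2 n (confPow (s - n / 2) ζ))
      (toL2 n (α n s 0 • confPow (-(n / 2 + s)) ζ)) := by
  refine (isImage_toL2_iff _ _).2 fun ℓ A hA hA0 => ?_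
  rw [α_mul_integral_harmonic_mul_confPow hs hA hA0 hζ, ← integral_const_mul, mul_smul_comm]
  rfl

theorem isImage_confField_mul_confPow (hs : Admissible n s) (hζ : ‖ζ‖ < 1) (e : Eu n) :
    IsImage n s (toL2 n (confField ζ e * confPow (s - n / 2) ζ))
      (toL2 n (α n s 1 • (confField ζ e * confPow (-(n / 2 + s)) ζ))) := by
  refine (isImage_toL2_iff _ _).2 fun ℓ A hA hA0 => ?_
  have hβ : (n : ℝ) / 2 - s ≠ 0 := by linarith [hs.pos]
  have hl := (hasDerivAt_integral_confPow (restrictPoly n A) (s - n / 2) hζ e).const_mul (α n s ℓ)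
  have hr := (hasDerivAt_integral_confPow (restrictPoly n A) (-(n / 2 + s)) hζ e).const_mul
    (α n s 0)
  have heq := hl.unique (hr.congr_of_eventuallyEq
    ((eventually_norm_add_smul_lt_one hζ e).mono fun t ht =>
      α_mul_integral_harmonic_mul_confPow hs hA hA0 ht))
  have hsmul : ∫ ω, (restrictPoly n A *
        (α n s 1 • (confField ζ e * confPow (-(n / 2 + s)) ζ))) ω ∂surf n =
      α n s 1 * ∫ ω, (restrictPoly n A * (confField ζ e * confPow (-(n / 2 + s)) ζ)) ω ∂surf n := by
    rw [← integral_const_mul, mul_smul_comm]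
    rfl
  rw [hsmul]
  refine mul_left_cancel₀ hβ ?_
  linear_combination heq -
    (∫ ω, (restrictPoly n A * (confField ζ e * confPow (-(n / 2 + s)) ζ)) ω ∂surf n) * α_one_eq hs

end Intertwining

section TangentSpace

lemma mem_submodule_of_forall_hasDerivAt {X : Type*} (V : Submodule ℝ (X → ℝ))
    [FiniteDimensional ℝ V] {g : ℝ → X → ℝ} {g' : X → ℝ} {t₀ : ℝ} (hg : ∀ᶠ t in 𝓝 t₀, g t ∈ V)
    (hg' : ∀ x, HasDerivAt (fun t => g t x) (g' x) t₀) : g' ∈ V := by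
  have hslope : Filter.Tendsto (slope g t₀) (𝓝[≠] t₀) (𝓝 g') :=
    tendsto_pi_nhds.2 fun x => hasDerivAt_iff_tendsto_slope.1 (hg' x)
  refine V.closed_of_finiteDimensional.mem_of_tendsto hslope ?_
  filter_upwards [nhdsWithin_le_nhds hg] with t ht
  exact V.smul_mem _ (V.sub_mem ht hg.self_of_nhds)

variable {n : ℕ} {s : ℝ} {c : ℝ} {ζ : Eu n}

lemma mem_optimizers_iff {h : C(Sph n, ℝ)} :
    h ∈ optimizers n s ↔
      ∃ c : ℝ, 0 < c ∧ ∃ ζ : Eu n, ‖ζ‖ < 1 ∧ h = c • confPow (s - n / 2) ζ := by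
  have hconf {ζ : Eu n} (hζ : ‖ζ‖ < 1) (ω : Sph n) :
      (1 - inner ℝ ζ (ω : Eu n)) ^ ((2 * s - n) / 2) =
        √(1 - ‖ζ‖ ^ 2) ^ (s - n / 2) * confPow (s - n / 2) ζ ω := by
    rw [← one_sub_inner_rpow hζ, show (2 * s - n) / 2 = s - n / 2 by ring]
  constructor
  · rintro ⟨c, hc, ζ, hζ, h_eq⟩
    have hq := Real.sqrt_pos.2 (one_sub_norm_sq_pos hζ)
    refine ⟨c * √(1 - ‖ζ‖ ^ 2) ^ (s - n / 2), by positivity, ζ, hζ, ContinuousMap.ext fun ω => ?_⟩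
    rw [h_eq, hconf hζ, ContinuousMap.smul_apply, smul_eq_mul, mul_assoc]
  · rintro ⟨c, hc, ζ, hζ, rfl⟩
    have hq := Real.sqrt_pos.2 (one_sub_norm_sq_pos hζ)
    refine ⟨c / √(1 - ‖ζ‖ ^ 2) ^ (s - n / 2), by positivity, ζ, hζ, fun ω => ?_⟩
    rw [hconf hζ, ContinuousMap.smul_apply, smul_eq_mul]
    field_simp

/-- The affine function `ω ↦ a + b·ω` on the sphere, depending linearly on `(a, b)`. -/
def affineOnSphere (n : ℕ) : ℝ × Eu n →ₗ[ℝ] (Sph n → ℝ) where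
  toFun p ω := p.1 + inner ℝ p.2 (ω : Eu n)
  map_add' p q := by
    ext ω
    simp only [Prod.fst_add, Prod.snd_add, inner_add_left, Pi.add_apply]
    ring
  map_smul' c p := by
    ext ω
    simp only [Prod.smul_fst, Prod.smul_snd, real_inner_smul_left, Pi.smul_apply, smul_eq_mul,
      RingHom.id_apply]
    ring

lemma smul_confPow_rpow_inv (hc : 0 < c) (hζ : ‖ζ‖ < 1) {κ : ℝ} (hκ : κ ≠ 0) (ω : Sph n) :
    (c • confPow κ ζ) ω ^ κ⁻¹ = c ^ κ⁻¹ * confFactor ζ ω := by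
  rw [ContinuousMap.smul_apply, smul_eq_mul, confPow_apply hζ,
    Real.mul_rpow hc.le (Real.rpow_nonneg (confFactor_pos hζ ω).le κ),
    Real.rpow_rpow_inv (confFactor_pos hζ ω).le hκ]

lemma rpow_inv_mem_range_affineOnSphere (hβ : s - n / 2 ≠ 0) {h : C(Sph n, ℝ)}
    (hh : h ∈ optimizers n s) :
    (fun ω => h ω ^ (s - n / 2)⁻¹) ∈ LinearMap.range (affineOnSphere n) := by
  obtain ⟨c, hc, ζ, hζ, rfl⟩ := mem_optimizers_iff.1 hh
  set k := c ^ (s - n / 2)⁻¹ / √(1 - ‖ζ‖ ^ 2)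
  refine ⟨(k, -(k • ζ)), funext fun ω => ?_⟩
  rw [smul_confPow_rpow_inv hc hζ hβ, confFactor]
  simp only [affineOnSphere, LinearMap.coe_mk, AddHom.coe_mk, inner_neg_left,
    real_inner_smul_left, k]
  ring

lemma exists_affineOnSphere_eq (hζ : ‖ζ‖ < 1) (p : ℝ × Eu n) :
    ∃ (k : ℝ) (e : Eu n), ∀ ω, affineOnSphere n p ω = confFactor ζ ω * (k + confField ζ e ω) := by
  obtain ⟨a, b⟩ := p
  have hq := one_sub_norm_sq_pos hζ
  refine ⟨√(1 - ‖ζ‖ ^ 2) * (a + (inner ℝ ζ b + a * ‖ζ‖ ^ 2) / (1 - ‖ζ‖ ^ 2)),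
    √(1 - ‖ζ‖ ^ 2) • (b + a • ζ), fun ω => ?_⟩
  have hω := one_sub_inner_pos hζ ω
  rw [map_smul, ContinuousMap.smul_apply, confField_apply hζ, confFactor]
  simp only [affineOnSphere, LinearMap.coe_mk, AddHom.coe_mk, inner_add_left, inner_add_right,
    real_inner_smul_left, real_inner_smul_right, real_inner_self_eq_norm_sq, smul_eq_mul]
  field_simp
  ring

lemma add_confField_mul_confPow_mem_tangentSpace (hβ : s - n / 2 ≠ 0) (hc : 0 < c)
    (hζ : ‖ζ‖ < 1) (a : ℝ) (e : Eu n) :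
    a • confPow (s - n / 2) ζ + confField ζ e * confPow (s - n / 2) ζ ∈
      tangentSpace n s (c • confPow (s - n / 2) ζ) := by
  set β := s - n / 2
  set v := (-(c * β)⁻¹) • e with hv
  refine ⟨fun t => (c + t * a) • confPow β (ζ + t • v), ?_, by simp, fun ω => ?_⟩
  · have hpos : ∀ᶠ t : ℝ in 𝓝 0, 0 < c + t * a :=
      (by fun_prop : Continuous fun t : ℝ => c + t * a).continuousAt.eventually_const_lt
        (by simpa using hc)
    filter_upwards [hpos, eventually_norm_add_smul_lt_one hζ v] with t ht ht'
    exact mem_optimizers_iff.2 ⟨_, ht, _, ht', rfl⟩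
  · have hcoef : HasDerivAt (fun t : ℝ => c + t * a) a 0 := by
      simpa using ((hasDerivAt_id' (0 : ℝ)).mul_const a).const_add c
    have h := hcoef.mul (hasDerivAt_confPow (hasDerivAt_add_smul ζ v 0) (by simpa using hζ) β ω)
    refine h.congr_deriv ?_
    simp only [hv, zero_smul, zero_mul, add_zero, map_smul, ContinuousMap.add_apply,
      ContinuousMap.mul_apply, ContinuousMap.smul_apply, smul_eq_mul]
    field_simp

-- The functions `h ^ (1 / (s - n/2))` with `h ∈ 𝓜` are affine, hence so are their variations.
theorem exists_eq_of_mem_tangentSpace (hβ : s - n / 2 ≠ 0) (hc : 0 < c) (hζ : ‖ζ‖ < 1)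
    {η : C(Sph n, ℝ)} (hη : η ∈ tangentSpace n s (c • confPow (s - n / 2) ζ)) :
    ∃ (a : ℝ) (e : Eu n),
      η = a • confPow (s - n / 2) ζ + confField ζ e * confPow (s - n / 2) ζ := by
  obtain ⟨γ, hγ, hγ₀, hγ'⟩ := hη
  set β := s - n / 2
  set h := c • confPow β ζ with h_def
  have hh (ω : Sph n) : 0 < h ω := mul_pos hc (confPow_pos hζ β ω)
  have hd (ω : Sph n) :
      HasDerivAt (fun t => γ t ω ^ β⁻¹) (η ω * β⁻¹ * h ω ^ (β⁻¹ - 1)) 0 := by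
    simpa only [hγ₀] using (hγ' ω).rpow_const (p := β⁻¹) (Or.inl (by rw [hγ₀]; exact (hh ω).ne'))
  obtain ⟨p, hp⟩ := mem_submodule_of_forall_hasDerivAt (LinearMap.range (affineOnSphere n))
    (hγ.mono fun t ht => rpow_inv_mem_range_affineOnSphere hβ ht) hd
  obtain ⟨k, e, hke⟩ := exists_affineOnSphere_eq hζ p
  refine ⟨β * c ^ (-β⁻¹) * c * k, (β * c ^ (-β⁻¹) * c) • e, ContinuousMap.ext fun ω => ?_⟩
  have hη_eq := (congrFun hp ω).symm.trans (hke ω)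
  rw [Real.rpow_sub_one (hh ω).ne', smul_confPow_rpow_inv hc hζ hβ, h_def] at hη_eq
  have hF := confFactor_pos hζ ω
  have hK := confPow_pos hζ β ω
  simp only [ContinuousMap.add_apply, ContinuousMap.smul_apply, ContinuousMap.mul_apply,
    smul_eq_mul, map_smul, Real.rpow_neg hc.le] at hη_eq ⊢
  field_simp at hη_eq ⊢
  linear_combination hη_eq

lemma isImage_add_confField_mul_confPow (hs : Admissible n s) (hζ : ‖ζ‖ < 1) (a : ℝ) (e : Eu n) :
    IsImage n s (toL2 n (a • confPow (s - n / 2) ζ + confField ζ e * confPow (s - n / 2) ζ))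
      (toL2 n ((a * α n s 0) • confPow (-(n / 2 + s)) ζ +
        α n s 1 • (confField ζ e * confPow (-(n / 2 + s)) ζ))) := by
  rw [map_add, map_smul, map_add, mul_smul, map_smul]
  exact ((isImage_confPow hs hζ).const_smul a).add (isImage_confField_mul_confPow hs hζ e)

theorem mem_tangentPerp_iff (hs : Admissible n s) (hc : 0 < c) (hζ : ‖ζ‖ < 1) {ρ : L2 n} :
    ρ ∈ tangentPerp n s (c • confPow (s - n / 2) ζ) ↔ ρ ∈ Hs n s ∧
      inner ℝ ρ (toL2 n (confPow (-(n / 2 + s)) ζ)) = 0 ∧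
        ∀ e, inner ℝ ρ (toL2 n (confField ζ e * confPow (-(n / 2 + s)) ζ)) = 0 := by
  have hform (a : ℝ) (e : Eu n) := (isImage_add_confField_mul_confPow hs hζ a e).aBilin_eq ρ
  simp only [map_add (toL2 n) (_ • confPow (-(n / 2 + s)) ζ), map_smul (toL2 n), inner_add_right,
    real_inner_smul_right] at hform
  refine and_congr_right fun _ => ⟨fun h => ⟨?_, fun e => ?_⟩, fun h φ hφ => ?_⟩
  · have h₁ := h _ (add_confField_mul_confPow_mem_tangentSpace hs.pos.ne' hc hζ 1 0)
    rw [hform] at h₁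
    simpa [α_ne_zero hs 0, -neg_add_rev] using h₁
  · have h₁ := h _ (add_confField_mul_confPow_mem_tangentSpace hs.pos.ne' hc hζ 0 e)
    rw [hform] at h₁
    simpa [α_ne_zero hs 1, -neg_add_rev] using h₁
  · obtain ⟨a, e, rfl⟩ := exists_eq_of_mem_tangentSpace hs.pos.ne' hc hζ hφ
    rw [hform, h.1, h.2, mul_zero, mul_zero, add_zero]

end TangentSpace

section Positivity

variable {n : ℕ} {s : ℝ} {ζ : Eu n}

lemma aBilin_confPow (hs : Admissible n s) (hζ : ‖ζ‖ < 1) (u : L2 n) :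
    aBilin n s u (toL2 n (confPow (s - n / 2) ζ)) =
      α n s 0 * inner ℝ u (toL2 n (confPow (-(n / 2 + s)) ζ)) := by
  rw [(isImage_confPow hs hζ).aBilin_eq, map_smul, real_inner_smul_right]

lemma aBilin_confField_mul_confPow (hs : Admissible n s) (hζ : ‖ζ‖ < 1) (e : Eu n) (u : L2 n) :
    aBilin n s u (toL2 n (confField ζ e * confPow (s - n / 2) ζ)) =
      α n s 1 * inner ℝ u (toL2 n (confField ζ e * confPow (-(n / 2 + s)) ζ)) := by
  rw [(isImage_confField_mul_confPow hs hζ e).aBilin_eq, map_smul, real_inner_smul_right]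

lemma confPow_mul_confPow_conjugate (hζ : ‖ζ‖ < 1) (s : ℝ) :
    confPow (s - n / 2) ζ * confPow (-(n / 2 + s)) ζ = confPow (-n) ζ := by
  rw [confPow_mul_confPow hζ]
  ring_nf

lemma integral_confPow_mul_confPow (hζ : ‖ζ‖ < 1) (s : ℝ) :
    ∫ ω, confPow (s - n / 2) ζ ω * confPow (-(n / 2 + s)) ζ ω ∂surf n =
      (surf n).real Set.univ := by
  rw [← integral_confPow_neg_natCast hζ, ← confPow_mul_confPow_conjugate hζ s]
  rfl

lemma aBilin_confPow_self (hs : Admissible n s) (hζ : ‖ζ‖ < 1) :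
    aBilin n s (toL2 n (confPow (s - n / 2) ζ)) (toL2 n (confPow (s - n / 2) ζ)) =
      α n s 0 * (surf n).real Set.univ := by
  rw [aBilin_confPow hs hζ, inner_toL2, integral_confPow_mul_confPow hζ]

lemma aBilin_confField_mul_confPow_self (hs : Admissible n s) (hζ : ‖ζ‖ < 1) (e : Eu n) :
    aBilin n s (toL2 n (confField ζ e * confPow (s - n / 2) ζ))
      (toL2 n (confField ζ e * confPow (s - n / 2) ζ)) =
      α n s 1 * ∫ ω, (confField ζ e * confField ζ e * confPow (-n) ζ) ω ∂surf n := by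
  rw [aBilin_confField_mul_confPow hs hζ, inner_toL2, ← confPow_mul_confPow_conjugate hζ s,
    ← mul_mul_mul_comm]
  rfl

lemma integral_confField_sq_mul_confPow_pos (hζ : ‖ζ‖ < 1) {e : Eu n} (he : e ≠ 0) (κ : ℝ) :
    0 < ∫ ω, (confField ζ e * confField ζ e * confPow κ ζ) ω ∂surf n := by
  obtain ⟨ω, hω⟩ := DFunLike.ne_iff.1 (mt (eq_zero_of_confField_eq_zero hζ) he)
  exact integral_pos_of_continuous_of_ne (ContinuousMap.continuous _)
    (fun ω => mul_nonneg (mul_self_nonneg _) (confPow_pos hζ κ ω).le)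
    (mul_ne_zero (mul_ne_zero hω hω) (confPow_pos hζ κ ω).ne')

lemma area_pos (n : ℕ) : 0 < (surf n).real Set.univ := by
  have h := integral_pos_of_continuous_of_ne (μ := surf n) continuous_const (fun _ => zero_le_one)
    (x₀ := Classical.arbitrary (Sph n)) one_ne_zero
  simpa using h

theorem aForm_pos_of_lt_one (hs : Admissible n s) (hβ : s - n / 2 < 1) (hζ : ‖ζ‖ < 1)
    {ρ : sobolev n s} (hρ : ρ ≠ 0)
    (hort : inner ℝ (ρ : L2 n) (toL2 n (confPow (-(n / 2 + s)) ζ)) = 0) :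
    0 < aForm hs ρ ρ := by
  have hα₀ : α n s 0 < 0 := neg_of_mul_neg_left (α_zero_mul_neg hs) (by linarith)
  have hα₁ : 0 < α n s 1 := pos_of_mul_pos_left (α_one_mul_pos hs) (by linarith)
  have hα (ℓ : ℕ) (hℓ : ℓ ≠ 0) : 0 < α n s ℓ := by
    rcases eq_or_ne ℓ 1 with rfl | h
    · exact hα₁
    · exact α_pos_of_two_le hs (by lia)
  let k : sobolev n s := ⟨_, (isImage_confPow hs hζ).mem_Hs hs⟩
  refine aForm_pos_of_orthogonal hs hα (LinearMap.toSpanSingleton ℝ (sobolev n s) k)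
    (fun c hc => ?_) ?_ hρ fun c => ?_
  · rw [LinearMap.toSpanSingleton_apply, map_smul, map_smul, LinearMap.smul_apply, aForm_apply,
      aBilin_confPow_self hs hζ, smul_smul, smul_eq_mul]
    exact mul_neg_of_pos_of_neg (mul_self_pos.2 hc) (mul_neg_of_neg_of_pos hα₀ (area_pos n))
  · exact (finrank_sphericalHarmonics_zero_le n).trans_eq (Module.finrank_self ℝ).symm
  · rw [LinearMap.toSpanSingleton_apply, map_smul, aForm_apply, aBilin_confPow hs hζ, hort,
      mul_zero, smul_zero]

theorem aForm_pos_of_one_lt (hs : Admissible n s) (hβ : 1 < s - n / 2) (hζ : ‖ζ‖ < 1)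
    {ρ : sobolev n s} (hρ : ρ ≠ 0)
    (hort : ∀ e, inner ℝ (ρ : L2 n) (toL2 n (confField ζ e * confPow (-(n / 2 + s)) ζ)) = 0) :
    0 < aForm hs ρ ρ := by
  have hα₀ : 0 < α n s 0 := pos_of_mul_neg_left (α_zero_mul_neg hs) (by linarith)
  have hα₁ : α n s 1 < 0 := neg_of_mul_pos_left (α_one_mul_pos hs) (by linarith)
  have hα (ℓ : ℕ) (hℓ : ℓ ≠ 1) : 0 < α n s ℓ := by
    rcases eq_or_ne ℓ 0 with rfl | h
    · exact hα₀
    · exact α_pos_of_two_le hs (by lia)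
  let τ : Eu n →ₗ[ℝ] sobolev n s := LinearMap.codRestrict (sobolev n s)
    ((toL2 n).toLinearMap ∘ₗ LinearMap.mulRight ℝ (confPow (s - n / 2) ζ) ∘ₗ confField ζ)
    fun e => (isImage_confField_mul_confPow hs hζ e).mem_Hs hs
  refine aForm_pos_of_orthogonal hs hα τ (fun e he => ?_) ?_ hρ fun e => ?_
  · exact (aBilin_confField_mul_confPow_self hs hζ e).trans_lt
      (mul_neg_of_neg_of_pos hα₁ (integral_confField_sq_mul_confPow_pos hζ he _))
  · exact (finrank_sphericalHarmonics_one_le n).trans_eq finrank_euclideanSpace_fin.symm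
  · exact (aBilin_confField_mul_confPow hs hζ e ρ).trans (by rw [hort, mul_zero])

theorem aQuad_pos_of_mem_tangentPerp (hs : Admissible n s) {h : C(Sph n, ℝ)}
    (hh : h ∈ optimizers n s) {ρ : L2 n} (hρ : ρ ∈ tangentPerp n s h) (hρ0 : ρ ≠ 0) :
    0 < aQuad n s ρ := by
  obtain ⟨c, hc, ζ, hζ, rfl⟩ := mem_optimizers_iff.1 hh
  obtain ⟨hρs, hort₀, hort₁⟩ := (mem_tangentPerp_iff hs hc hζ).1 hρ
  lift ρ to sobolev n s using hρs
  replace hρ0 : ρ ≠ 0 := mt (congrArg Subtype.val) hρ0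
  rw [aQuad_eq_aForm hs]
  have hβ : s - n / 2 ≠ 1 := by simpa using hs.ne_natCast 1
  rcases hβ.lt_or_gt with hβ | hβ
  · exact aForm_pos_of_lt_one hs hβ hζ hρ0 hort₀
  · exact aForm_pos_of_one_lt hs hβ hζ hρ0 hort₁

end Positivity

section ConformalMoment

variable {n : ℕ} {s : ℝ} {f : C(Sph n, ℝ)} {ζ : Eu n}

/-- The pairing of `f` with `confPow (-(n / 2 + s)) ζ`; up to the factor `α n s 0` this is
`a_{2s}[f, confPow (s - n / 2) ζ]`. -/
def confMoment (s : ℝ) (f : C(Sph n, ℝ)) (ζ : Eu n) : ℝ :=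
  ∫ ω, (f * confPow (-(n / 2 + s)) ζ) ω ∂surf n

/-- The critical points of `confMoment s f` in the open unit ball, where the derivative is written
out according to `hasDerivAt_confMoment`. -/
def confCritical (s : ℝ) (f : C(Sph n, ℝ)) : Set (Eu n) :=
  {ζ | ‖ζ‖ < 1 ∧ ∀ e, ∫ ω, (f * (confField ζ e * confPow (-(n / 2 + s)) ζ)) ω ∂surf n = 0}

lemma hasDerivAt_confMoment (s : ℝ) (f : C(Sph n, ℝ)) (hζ : ‖ζ‖ < 1) (e : Eu n) :
    HasDerivAt (fun t : ℝ => confMoment s f (ζ + t • e))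
      ((n / 2 + s) * ∫ ω, (f * (confField ζ e * confPow (-(n / 2 + s)) ζ)) ω ∂surf n) 0 := by
  simpa only [confMoment, neg_neg] using hasDerivAt_integral_confPow f (-(n / 2 + s)) hζ e

lemma continuousOn_confMoment (s : ℝ) (f : C(Sph n, ℝ)) :
    ContinuousOn (confMoment s f) (Metric.ball 0 1) :=
  continuousOn_integral_of_compact_support isCompact_univ
    (ContinuousOn.mul (by fun_prop) (continuousOn_confPow _))
    fun _ ω _ hω => absurd (Set.mem_univ ω) hω

lemma isClosed_closedBall_inter_confCritical (s : ℝ) (f : C(Sph n, ℝ)) {R : ℝ} (hR : R < 1) :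
    IsClosed (Metric.closedBall 0 R ∩ confCritical s f) := by
  have hball : Metric.closedBall (0 : Eu n) R ⊆ Metric.ball 0 1 :=
    Metric.closedBall_subset_ball hR
  have hcont (e : Eu n) : ContinuousOn
      (fun ζ => ∫ ω, (f * (confField ζ e * confPow (-(n / 2 + s)) ζ)) ω ∂surf n)
      (Metric.ball 0 1) :=
    continuousOn_integral_of_compact_support isCompact_univ
      (ContinuousOn.mul (by fun_prop) ((continuousOn_confField e).mul (continuousOn_confPow _)))
      fun _ ω _ hω => absurd (Set.mem_univ ω) hω
  have hclosed := isClosed_iInter fun e =>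
    ((hcont e).mono hball).preimage_isClosed_of_isClosed Metric.isClosed_closedBall
      (isClosed_singleton (x := (0 : ℝ)))
  convert hclosed using 1
  ext ζ
  rw [← Set.inter_iInter]
  simp only [Set.mem_inter_iff, Set.mem_iInter, Set.mem_preimage, Set.mem_singleton_iff,
    confCritical, Set.mem_ofPred_eq]
  exact and_congr_right fun hζ => and_iff_right (mem_ball_zero_iff.1 (hball hζ))

lemma confMoment_pos (hf : ∀ ω, 0 < f ω) (hζ : ‖ζ‖ < 1) : 0 < confMoment s f ζ := by
  have hpos (ω : Sph n) : 0 < (f * confPow (-(n / 2 + s)) ζ) ω :=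
    mul_pos (hf ω) (confPow_pos hζ _ ω)
  exact integral_pos_of_continuous_of_ne (ContinuousMap.continuous _) (fun ω => (hpos ω).le)
    (hpos (Classical.arbitrary _)).ne'

lemma integral_inner_eq_zero (ζ : Eu n) : ∫ ω : Sph n, inner ℝ ζ (ω : Eu n) ∂surf n = 0 := by
  have h := polyIntegral_eq_zero_of_odd odd_one
    (pow_one (linPoly ζ) ▸ linPoly_pow_isHomogeneous ζ 1)
  simpa only [polyIntegral, LinearMap.coe_mk, AddHom.coe_mk, restrictPoly_linPoly] using h

lemma one_sub_two_mul_div_four_le_rpow {κ x : ℝ} (h0 : 0 ≤ κ) (h2 : κ ≤ 2) (hx : |x| < 1) :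
    (1 - 2 * x) / 4 ≤ (1 - x) ^ κ := by
  obtain ⟨hx₁, hx₂⟩ := abs_lt.1 hx
  have hy : 0 < (1 - x) / 2 := by linarith
  calc (1 - 2 * x) / 4 ≤ ((1 - x) / 2) ^ (2 : ℝ) := by
        rw [Real.rpow_two]
        nlinarith [sq_nonneg x]
    _ ≤ ((1 - x) / 2) ^ κ := Real.rpow_le_rpow_of_exponent_ge hy (by linarith) h2
    _ ≤ (1 - x) ^ κ := Real.rpow_le_rpow hy.le (by linarith) h0

lemma area_div_four_le_integral_confPow {κ : ℝ} (h0 : 0 ≤ κ) (h2 : κ ≤ 2) (hζ : ‖ζ‖ < 1) :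
    (surf n).real Set.univ / 4 ≤ √(1 - ‖ζ‖ ^ 2) ^ κ * ∫ ω, confPow κ ζ ω ∂surf n := by
  calc (surf n).real Set.univ / 4 = ∫ ω : Sph n, (1 - 2 * inner ℝ ζ (ω : Eu n)) / 4 ∂surf n := by
        rw [integral_div, integral_sub (integrable_const _)
          (integrable_of_continuous (by fun_prop)), integral_const_mul, integral_inner_eq_zero]
        simp
    _ ≤ ∫ ω, √(1 - ‖ζ‖ ^ 2) ^ κ * confPow κ ζ ω ∂surf n := by
        refine integral_mono (integrable_of_continuous (by fun_prop))
          (integrable_of_continuous (by fun_prop)) fun ω => ?_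
        dsimp only
        rw [← one_sub_inner_rpow hζ]
        exact one_sub_two_mul_div_four_le_rpow h0 h2 ((abs_inner_le_norm_left ζ ω).trans_lt hζ)
    _ = _ := integral_const_mul _ _

lemma le_sqrt_rpow_mul_confMoment (h0 : 0 ≤ s - n / 2) (h2 : s - n / 2 ≤ 2) {m : ℝ} (hm : 0 ≤ m)
    (hf : ∀ ω, m ≤ f ω) (hζ : ‖ζ‖ < 1) :
    m * ((surf n).real Set.univ / 4) ≤ √(1 - ‖ζ‖ ^ 2) ^ (s - n / 2) * confMoment s f ζ := by
  have hconj : (-n - (s - n / 2) : ℝ) = -(n / 2 + s) := by ring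
  have hmean := area_div_four_le_integral_confPow h0 h2 hζ
  rw [integral_confPow _ hζ, hconj] at hmean
  calc m * ((surf n).real Set.univ / 4) ≤
        m * (√(1 - ‖ζ‖ ^ 2) ^ (s - n / 2) * ∫ ω, confPow (-(n / 2 + s)) ζ ω ∂surf n) := by gcongr
    _ = √(1 - ‖ζ‖ ^ 2) ^ (s - n / 2) * ∫ ω, m * confPow (-(n / 2 + s)) ζ ω ∂surf n := by
        rw [integral_const_mul, mul_left_comm]
    _ ≤ √(1 - ‖ζ‖ ^ 2) ^ (s - n / 2) * confMoment s f ζ := by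
        refine mul_le_mul_of_nonneg_left (integral_mono (integrable_of_continuous (by fun_prop))
          (integrable_of_continuous (by fun_prop)) fun ω => ?_) (by positivity)
        exact mul_le_mul_of_nonneg_right (hf ω) (confPow_pos hζ _ ω).le

theorem exists_norm_le_of_confMoment_le (h0 : 0 < s - n / 2) (h2 : s - n / 2 ≤ 2)
    (hf : ∀ ω, 0 < f ω) {B : ℝ} (hB : 0 < B) :
    ∃ R < 1, ∀ ζ : Eu n, ‖ζ‖ < 1 → confMoment s f ζ ≤ B → ‖ζ‖ ≤ R := by
  obtain ⟨ω₀, -, hmin⟩ := isCompact_univ.exists_isMinOn Set.univ_nonempty f.continuous.continuousOn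
  set K := f ω₀ * ((surf n).real Set.univ / 4)
  have hK : 0 < K := mul_pos (hf ω₀) (by linarith [area_pos n])
  set δ := (K / B) ^ (s - n / 2)⁻¹
  have hδ : 0 < δ := by positivity
  refine ⟨√(1 - δ ^ 2), (Real.sqrt_lt' one_pos).2 (by nlinarith), fun ζ hζ hle => ?_⟩
  have hbound : K / B ≤ √(1 - ‖ζ‖ ^ 2) ^ (s - n / 2) := by
    rw [div_le_iff₀ hB]
    exact (le_sqrt_rpow_mul_confMoment h0.le h2 (hf ω₀).le
      (fun ω => hmin (Set.mem_univ ω)) hζ).trans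
      (mul_le_mul_of_nonneg_left hle (by positivity))
  have hδ_le : δ ≤ √(1 - ‖ζ‖ ^ 2) :=
    (Real.rpow_inv_le_iff_of_pos (by positivity) (Real.sqrt_nonneg _) h0).2 hbound
  have hsq := (Real.le_sqrt hδ.le (one_sub_norm_sq_pos hζ).le).1 hδ_le
  exact Real.le_sqrt_of_sq_le (by linarith)

theorem confCritical_nonempty (h0 : 0 < s - n / 2) (h2 : s - n / 2 ≤ 2) (hf : ∀ ω, 0 < f ω) :
    (confCritical s f).Nonempty := by
  have hM0 : 0 < confMoment s f 0 := confMoment_pos hf (by simp)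
  obtain ⟨R, hR1, hR⟩ := exists_norm_le_of_confMoment_le h0 h2 hf hM0
  have h0mem : (0 : Eu n) ∈ Metric.closedBall 0 R :=
    mem_closedBall_zero_iff.2 (hR 0 (by simp) le_rfl)
  have hball : Metric.closedBall (0 : Eu n) R ⊆ Metric.ball 0 1 := Metric.closedBall_subset_ball hR1
  obtain ⟨ζ, hζR, hmin⟩ := (isCompact_closedBall (0 : Eu n) R).exists_isMinOn ⟨0, h0mem⟩
    ((continuousOn_confMoment s f).mono hball)
  have hζ : ‖ζ‖ < 1 := mem_ball_zero_iff.1 (hball hζR)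
  have hglobal (η : Eu n) (hη : ‖η‖ < 1) : confMoment s f ζ ≤ confMoment s f η := by
    rcases le_total (confMoment s f η) (confMoment s f 0) with h | h
    · exact hmin (mem_closedBall_zero_iff.2 (hR η hη h))
    · exact (hmin h0mem).trans h
  refine ⟨ζ, hζ, fun e => ?_⟩
  have hlocal : IsLocalMin (fun t : ℝ => confMoment s f (ζ + t • e)) 0 := by
    filter_upwards [eventually_norm_add_smul_lt_one hζ e] with t ht
    simpa only [zero_smul, add_zero] using hglobal _ ht
  have hexp : (n / 2 + s : ℝ) ≠ 0 := by linarith [n.cast_nonneg (α := ℝ)]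
  exact (mul_eq_zero.1 (hlocal.hasDerivAt_eq_zero (hasDerivAt_confMoment s f hζ e))).resolve_left
    hexp

end ConformalMoment

section Decomposition

variable {n : ℕ} {s : ℝ} {f : C(Sph n, ℝ)} {ζ : Eu n} {c : ℝ}

lemma inner_sub_smul_confPow (s : ℝ) (f : C(Sph n, ℝ)) (hζ : ‖ζ‖ < 1) (c : ℝ) :
    inner ℝ (toL2 n f - toL2 n (c • confPow (s - n / 2) ζ)) (toL2 n (confPow (-(n / 2 + s)) ζ)) =
      confMoment s f ζ - c * (surf n).real Set.univ := by
  rw [map_smul, inner_sub_left, real_inner_smul_left, inner_toL2, inner_toL2,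
    integral_confPow_mul_confPow hζ]
  rfl

lemma inner_sub_smul_confField_mul_confPow (hn : n ≠ 0) (s : ℝ) (f : C(Sph n, ℝ)) (hζ : ‖ζ‖ < 1)
    (c : ℝ) (e : Eu n) :
    inner ℝ (toL2 n f - toL2 n (c • confPow (s - n / 2) ζ))
        (toL2 n (confField ζ e * confPow (-(n / 2 + s)) ζ)) =
      ∫ ω, (f * (confField ζ e * confPow (-(n / 2 + s)) ζ)) ω ∂surf n := by
  have h : ∫ ω, (confPow (s - n / 2) ζ * (confField ζ e * confPow (-(n / 2 + s)) ζ)) ω ∂surf n =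
      0 := by
    rw [mul_left_comm, confPow_mul_confPow_conjugate hζ,
      integral_confField_mul_confPow_neg_natCast hn hζ]
  rw [map_smul, inner_sub_left, real_inner_smul_left, inner_toL2, inner_toL2]
  simp only [ContinuousMap.mul_apply] at h ⊢
  rw [h, mul_zero, sub_zero]

theorem sub_smul_confPow_mem_tangentPerp_iff (hn : n ≠ 0) (hs : Admissible n s)
    (hu : toL2 n f ∈ Hs n s) (hc : 0 < c) (hζ : ‖ζ‖ < 1) :
    toL2 n f - toL2 n (c • confPow (s - n / 2) ζ) ∈ tangentPerp n s (c • confPow (s - n / 2) ζ) ↔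
      c * (surf n).real Set.univ = confMoment s f ζ ∧ ζ ∈ confCritical s f := by
  have hmem : toL2 n f - toL2 n (c • confPow (s - n / 2) ζ) ∈ Hs n s := by
    rw [map_smul]
    exact (sobolev n s).sub_mem hu ((sobolev n s).smul_mem c ((isImage_confPow hs hζ).mem_Hs hs))
  rw [mem_tangentPerp_iff hs hc hζ, and_iff_right hmem, inner_sub_smul_confPow s f hζ]
  simp only [inner_sub_smul_confField_mul_confPow hn s f hζ, confCritical, Set.mem_ofPred_eq, hζ,
    true_and, sub_eq_zero, eq_comm (a := confMoment s f ζ)]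

/-- The value of `a_{2s}[ρ]` in the decomposition `f = h + ρ` belonging to the critical point
`ζ`. -/
def criticalValue (s : ℝ) (f : C(Sph n, ℝ)) (ζ : Eu n) : ℝ :=
  aQuad n s (toL2 n f) - α n s 0 * confMoment s f ζ ^ 2 / (surf n).real Set.univ

lemma aQuad_sub_smul_confPow (hs : Admissible n s) (hu : toL2 n f ∈ Hs n s) (hζ : ‖ζ‖ < 1)
    (hc : c * (surf n).real Set.univ = confMoment s f ζ) :
    aQuad n s (toL2 n f - toL2 n (c • confPow (s - n / 2) ζ)) = criticalValue s f ζ := by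
  let u : sobolev n s := ⟨toL2 n f, hu⟩
  let k : sobolev n s := ⟨_, (isImage_confPow hs hζ).mem_Hs hs⟩
  have huk : aForm hs u k = α n s 0 * confMoment s f ζ :=
    (aBilin_confPow hs hζ _).trans (by rw [inner_toL2]; rfl)
  have hkk : aForm hs k k = α n s 0 * (surf n).real Set.univ := aBilin_confPow_self hs hζ
  have hku : aForm hs k u = aForm hs u k := ((aForm_isSymm hs).eq u k).symm
  rw [map_smul, criticalValue]
  change aQuad n s (u - c • k : sobolev n s) = aQuad n s (u : L2 n) - _
  rw [aQuad_eq_aForm hs, aQuad_eq_aForm hs]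
  simp only [map_sub, map_smul, LinearMap.sub_apply, LinearMap.smul_apply, smul_eq_mul, hku, huk,
    hkk, ← hc]
  field_simp
  ring

theorem distValues_eq_image (hn : n ≠ 0) (hs : Admissible n s) (hu : toL2 n f ∈ Hs n s)
    (hf : ∀ ω, 0 < f ω) :
    distValues n s (toL2 n f) = criticalValue s f '' confCritical s f := by
  have hA := area_pos n
  ext t
  constructor
  · rintro ⟨h, hh, ρ, hρ, hsum, rfl⟩
    obtain ⟨c, hc, ζ, hζ, rfl⟩ := mem_optimizers_iff.1 hh
    obtain rfl : ρ = toL2 n f - toL2 n (c • confPow (s - n / 2) ζ) := by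
      rw [hsum, add_sub_cancel_left]
    obtain ⟨hcM, hcrit⟩ := (sub_smul_confPow_mem_tangentPerp_iff hn hs hu hc hζ).1 hρ
    exact ⟨ζ, hcrit, (aQuad_sub_smul_confPow hs hu hζ hcM).symm⟩
  · rintro ⟨ζ, hcrit, rfl⟩
    have hζ : ‖ζ‖ < 1 := hcrit.1
    have hc : 0 < confMoment s f ζ / (surf n).real Set.univ := div_pos (confMoment_pos hf hζ) hA
    have hcM := div_mul_cancel₀ (confMoment s f ζ) hA.ne'
    exact ⟨_, mem_optimizers_iff.2 ⟨_, hc, ζ, hζ, rfl⟩, _,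
      (sub_smul_confPow_mem_tangentPerp_iff hn hs hu hc hζ).2 ⟨hcM, hcrit⟩,
      (add_sub_cancel _ _).symm, (aQuad_sub_smul_confPow hs hu hζ hcM).symm⟩

lemma distValues_nonempty (hn : n ≠ 0) (hs : Admissible n s) (hu : toL2 n f ∈ Hs n s)
    (hf : ∀ ω, 0 < f ω) : (distValues n s (toL2 n f)).Nonempty := by
  rw [distValues_eq_image hn hs hu hf]
  exact (confCritical_nonempty hs.pos hs.lt_two.le hf).image _

lemma nonneg_of_mem_distValues (hs : Admissible n s) {u : L2 n} {t : ℝ}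
    (ht : t ∈ distValues n s u) : 0 ≤ t := by
  obtain ⟨h, hh, ρ, hρ, -, rfl⟩ := ht
  rcases eq_or_ne ρ 0 with rfl | hρ0
  · simp [aQuad]
  · exact (aQuad_pos_of_mem_tangentPerp hs hh hρ hρ0).le

lemma pos_of_mem_distValues (hs : Admissible n s) {u : L2 n} (hu : u ∉ toL2 n '' optimizers n s)
    {t : ℝ} (ht : t ∈ distValues n s u) : 0 < t := by
  obtain ⟨h, hh, ρ, hρ, rfl, rfl⟩ := ht
  refine aQuad_pos_of_mem_tangentPerp hs hh hρ ?_
  rintro rfl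
  exact hu ⟨h, hh, (add_zero _).symm⟩

-- By positivity a bound on the value bounds `confMoment`, whatever the sign of `α n s 0`.
lemma exists_norm_le_of_criticalValue_le (hn : n ≠ 0) (hs : Admissible n s)
    (hu : toL2 n f ∈ Hs n s) (hf : ∀ ω, 0 < f ω) (t : ℝ) :
    ∃ R < 1, ∀ ζ ∈ confCritical s f, criticalValue s f ζ ≤ t → ‖ζ‖ ≤ R := by
  have hA := area_pos n
  have hα : 0 < |α n s 0| := abs_pos.2 (α_ne_zero hs 0)
  set Q := aQuad n s (toL2 n f)
  set C := (|Q| + |t|) * (surf n).real Set.univ / |α n s 0|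
  obtain ⟨R, hR1, hR⟩ := exists_norm_le_of_confMoment_le hs.pos hs.lt_two.le hf
    (B := C + 1) (by positivity)
  refine ⟨R, hR1, fun ζ hζ hζt => hR ζ hζ.1 ?_⟩
  have hnonneg : 0 ≤ criticalValue s f ζ := nonneg_of_mem_distValues hs
    (distValues_eq_image hn hs hu hf ▸ Set.mem_image_of_mem _ hζ)
  have habs : |α n s 0| * confMoment s f ζ ^ 2 / (surf n).real Set.univ ≤ |Q| + |t| :=
    calc |α n s 0| * confMoment s f ζ ^ 2 / (surf n).real Set.univ =
          |Q - criticalValue s f ζ| := by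
          rw [criticalValue, sub_sub_cancel, abs_div, abs_mul, abs_sq, abs_of_pos hA]
      _ ≤ |Q| + |criticalValue s f ζ| := abs_sub _ _
      _ ≤ |Q| + |t| := by gcongr
  rw [div_le_iff₀ hA, mul_comm, ← le_div_iff₀ hα] at habs
  nlinarith [sq_nonneg (confMoment s f ζ - 1)]

theorem isCompact_distValues_inter_Iic (hn : n ≠ 0) (hs : Admissible n s) (hu : toL2 n f ∈ Hs n s)
    (hf : ∀ ω, 0 < f ω) (t : ℝ) : IsCompact (distValues n s (toL2 n f) ∩ Set.Iic t) := by
  obtain ⟨R, hR1, hR⟩ := exists_norm_le_of_criticalValue_le hn hs hu hf t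
  have hcompact : IsCompact (Metric.closedBall 0 R ∩ confCritical s f) :=
    (isCompact_closedBall (0 : Eu n) R).of_isClosed_subset
      (isClosed_closedBall_inter_confCritical s f hR1) Set.inter_subset_left
  have hcont : ContinuousOn (criticalValue s f) (Metric.ball 0 1) := continuousOn_const.sub
    ((continuousOn_const.mul ((continuousOn_confMoment s f).pow 2)).div_const _)
  have himage := (hcompact.image_of_continuousOn
    (hcont.mono fun ζ hζ => mem_ball_zero_iff.2 hζ.2.1)).inter_right (isClosed_Iic (a := t))
  rw [distValues_eq_image hn hs hu hf]
  convert himage using 1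
  refine Set.Subset.antisymm ?_ (Set.inter_subset_inter_left _
    (Set.image_mono Set.inter_subset_right))
  rintro _ ⟨⟨ζ, hζ, rfl⟩, hζt⟩
  exact ⟨⟨ζ, ⟨mem_closedBall_zero_iff.2 (hR ζ hζ hζt), hζ⟩, rfl⟩, hζt⟩

theorem exists_isLeast_distValues (hn : n ≠ 0) (hs : Admissible n s) (hu : toL2 n f ∈ Hs n s)
    (hf : ∀ ω, 0 < f ω) : ∃ t, IsLeast (distValues n s (toL2 n f)) t := by
  obtain ⟨t₀, ht₀⟩ := distValues_nonempty hn hs hu hf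
  obtain ⟨t, ⟨ht, htt₀⟩, hmin⟩ :=
    (isCompact_distValues_inter_Iic hn hs hu hf t₀).exists_isLeast ⟨t₀, ht₀, Set.mem_Iic.2 le_rfl⟩
  refine ⟨t, ht, fun r hr => ?_⟩
  rcases le_total r t₀ with h | h
  · exact hmin ⟨hr, h⟩
  · exact htt₀.trans h

end Decomposition

end ReverseSobolev

end

theorem mainTheorem4 (n : ℕ) (hn : 1 ≤ n) (s : ℝ)
    (hs : s - n / 2 ∈ Set.Ioo (0 : ℝ) 1 ∪ Set.Ioo (1 : ℝ) 2) :
    (∀ h ∈ ReverseSobolev.optimizers n s, ∀ ρ ∈ ReverseSobolev.tangentPerp n s h,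
        ρ ≠ 0 → 0 < ReverseSobolev.aQuad n s ρ) ∧
    ∀ u ∈ ReverseSobolev.Hs n s, ReverseSobolev.IsPos u →
      (∃ h ∈ ReverseSobolev.optimizers n s,
        ∃ ρ ∈ ReverseSobolev.tangentPerp n s h, u = ReverseSobolev.toL2 n h + ρ) ∧
      (ReverseSobolev.distValues n s u).Nonempty ∧
      BddBelow (ReverseSobolev.distValues n s u) ∧
      (u ∉ ReverseSobolev.toL2 n '' ReverseSobolev.optimizers n s →
        0 < ReverseSobolev.dist n s u) := by
  have hs' : ReverseSobolev.Admissible n s := hs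
  have hn' : n ≠ 0 := Nat.one_le_iff_ne_zero.1 hn
  refine ⟨fun h hh ρ hρ hρ0 => ReverseSobolev.aQuad_pos_of_mem_tangentPerp hs' hh hρ hρ0, ?_⟩
  rintro _ hu ⟨f, rfl, hf⟩
  have hne := ReverseSobolev.distValues_nonempty hn' hs' hu hf
  refine ⟨?_, hne, ⟨0, fun t ht => ReverseSobolev.nonneg_of_mem_distValues hs' ht⟩, fun hnot => ?_⟩
  · obtain ⟨_, h, hh, ρ, hρ, hsum, -⟩ := hne
    exact ⟨h, hh, ρ, hρ, hsum⟩
  · obtain ⟨t, ht⟩ := ReverseSobolev.exists_isLeast_distValues hn' hs' hu hf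
    rw [ReverseSobolev.dist, ht.csInf_eq]
    exact ReverseSobolev.pos_of_mem_distValues hs' hnot ht.1
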